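/- Let $k$ be a field and let $S$ be a finite product of copies of $k$, regarded as a $k$-algebra concentrated in degree $0$. All tensor products are over $S$, and signs follow the Koszul rule $(f\otimes g)(x\otimes y)=(-1)^{|g||x|}f(x)\otimes g(y)$. Let $A$ be a (not necessarily unital) $A_\infty$-algebra over $S$: a $\mathbb Z$-graded $S$-$S$-bimodule on which $k$ acts centrally, with homogeneous bimodule morphisms $m_n:A^{\otimes n}\to A$ of degree $2-n$ ($n\ge 1$) such that $\sum_{r+s+t=n,\ s\ge1}(-1)^{r+st}m_{r+1+t}(\mathrm{id}^{\otimes r}\otimes m_s\otimes \mathrm{id}^{\otimes t})=0$ for all $n\ge1$. A right $A_\infty$-module over $A$ is a $\mathbb Z$-graded right $S$-module $M$ with homogeneous morphisms of right $S$-modules $m^M_n:M\otimes A^{\otimes(n-1)}\to M$ of degree $2-n$ ($n\ge1$) such that, for all $n\ge 1$, $$\sum_{r+s+t=n,\ r,s\ge1}(-1)^{r+st}m^M_{r+1+t}(\mathrm{id}^{\otimes r}\otimes m_s\otimes \mathrm{id}^{\otimes t})+\sum_{s+t=n,\ s\ge1}(-1)^{st}m^M_{1+t}(m^M_s\otimes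 \mathrm{id}^{\otimes t})=0.$$ A morphism $f:M\to N$ is a family of homogeneous morphisms of right $S$-modules $f_n:M\otimes A^{\otimes(n-1)}\to N$ of degree $1-n$ ($n\ge 1$) such that, for all $n\ge1$, $$\sum_{r+s+t=n,\ r,s\ge1}(-1)^{r+st}f_{r+1+t}(\mathrm{id}^{\otimes r}\otimes m_s\otimes \mathrm{id}^{\otimes t})+\sum_{s+t=n,\ s\ge1}(-1)^{st}f_{1+t}(m^M_s\otimes \mathrm{id}^{\otimes t})=\sum_{r+s=n,\ r\ge1}(-1)^{(r+1)s}m^N_{1+s}(f_r\otimes \mathrm{id}^{\otimes s}).$$ Composition is given by $(g\circ f)_n=\sum_{r+s=n,\ r\ge1}(-1)^{(r+1)s}g_{1+s}(f_r\otimes \mathrm{id}^{\otimes s})$, and the identity of $M$ has first component $\mathrm{id}_M$ and all others zero; this is the category $\mathrm{Mod}_\infty\text{-}A$. Two morphisms $f,g:M\to N$ are homotopic if there are homogeneous morphisms of right $S$-modules $h_n:M\otimes A^{\otimes(n-1)}\to N$ of degree $-n$ ($n\ge1$) such that, for all $n\ge1$, $$f_n-g_n=\sum_{r+s=n,\ r\ge1}(-1)^{rs}m^N_{1+s}(h_r\otimes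 \mathrm{id}^{\otimes s})+\sum_{s+t=n,\ s\ge1}(-1)^{st}h_{1+t}(m^M_s\otimes \mathrm{id}^{\otimes t})+\sum_{r+s+t=n,\ r,s\ge1}(-1)^{r+st}h_{r+1+t}(\mathrm{id}^{\otimes r}\otimes m_s\otimes \mathrm{id}^{\otimes t}).$$ The homotopy category $\underline{\mathrm{Mod}}_\infty\text{-}A$ is the quotient of $\mathrm{Mod}_\infty\text{-}A$ by this relation. Theorem. Let $f:M\to N$ be a morphism of right $A_\infty$-modules over $A$ which is a quasi-isomorphism, that is, its first component $f_1:(M,m_1^M)\to(N,m_1^N)$ is a quasi-isomorphism of complexes of right $S$-modules. Then $f$ is a homotopy equivalence: there is a morphism $g:N\to M$ such that $g\circ f$ is homotopic to $\mathrm{id}_M$ and $f\circ g$ is homotopic to $\mathrm{id}_N$. Hence the class of $f$ is an isomorphism in $\underline{\mathrm{Mod}}_\infty\text{-}A$. -/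

import Mathlib

open CategoryTheory MulOpposite

universe u₁ u₂ u₃ v w

namespace AInf

/-- A `ℤ`-graded right `S`-module: a right `S`-module (a module over the opposite ring, with
`op s • x` playing the role of `x s`) together with a direct sum decomposition into right
`S`-submodules indexed by `ℤ`. -/
structure GrMod (S : Type u₂) [Ring S] where
  carrier : Type w
  [addCommGroup : AddCommGroup carrier]
  [rightModule : Module Sᵐᵒᵖ carrier]
  deg : ℤ → Submodule Sᵐᵒᵖ carrier
  internal : DirectSum.IsInternal deg

namespace GrMod

variable {S : Type u₂} [Ring S]

instance : CoeSort (GrMod.{u₂, w} S) (Type w) := ⟨GrMod.carrier⟩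

instance (M : GrMod.{u₂, w} S) : AddCommGroup M := M.addCommGroup

instance (M : GrMod.{u₂, w} S) : Module Sᵐᵒᵖ M := M.rightModule

noncomputable instance (M : GrMod.{u₂, w} S) : DirectSum.Decomposition M.deg :=
  M.internal.chooseDecomposition

/-- The Koszul sign operator: `M.koszul d x = (-1) ^ (d * |x|) x` for homogeneous `x`
(see `koszul_of_mem`), extended additively.  With it the sign rule
`(f ⊗ g) (x ⊗ y) = (-1) ^ (|g| * |x|) f x ⊗ g y` reads
`(f ⊗ g) (x ⊗ y) = f (koszul |g| x) ⊗ g y`. -/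
noncomputable def koszul (M : GrMod.{u₂, w} S) (d : ℤ) : M →ₗ[Sᵐᵒᵖ] M :=
  (DirectSum.toModule Sᵐᵒᵖ ℤ M fun j => (d * j).negOnePow • (M.deg j).subtype) ∘ₗ
    (DirectSum.decomposeLinearEquiv M.deg).toLinearMap

theorem koszul_of_mem (M : GrMod.{u₂, w} S) (d : ℤ) {j : ℤ} {x : M} (hx : x ∈ M.deg j) :
    M.koszul d x = (d * j).negOnePow • x := by
  have h := DirectSum.decomposeLinearEquiv_apply_coe M.deg j ⟨x, hx⟩
  simp only at h
  simp only [koszul, LinearMap.comp_apply, LinearEquiv.coe_coe, h, DirectSum.toModule_lof]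
  rfl

end GrMod

/-- A `ℤ`-graded `S`-`S`-bimodule on which the ground field `k` acts centrally; the homogeneous
components are subbimodules. -/
structure GrBimod (k : Type u₁) (S : Type u₂) [Field k] [Ring S] [Algebra k S]
    extends GrMod.{u₂, v} S where
  [leftModule : Module S carrier]
  [smulComm : SMulCommClass S Sᵐᵒᵖ carrier]
  central : ∀ (c : k) (a : carrier), algebraMap k S c • a = op (algebraMap k S c) • a
  left_mem : ∀ (s : S) (j : ℤ) (a : carrier), a ∈ deg j → s • a ∈ deg j

namespace GrBimod

variable {k : Type u₁} {S : Type u₂} [Field k] [Ring S] [Algebra k S]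

instance : CoeSort (GrBimod.{u₁, u₂, v} k S) (Type v) := ⟨fun A => A.carrier⟩

instance (A : GrBimod.{u₁, u₂, v} k S) : Module S A := A.leftModule

instance (A : GrBimod.{u₁, u₂, v} k S) : SMulCommClass S Sᵐᵒᵖ A := A.smulComm

end GrBimod

/-- All entries of the list `l` are homogeneous, of the degrees recorded in the list `js`. -/
def HomogList {S : Type u₂} [Ring S] (M : GrMod.{u₂, v} S) (l : List M) (js : List ℤ) : Prop :=
  List.Forall₂ (fun a j => a ∈ M.deg j) l js

/-- The triples `(r, s, t)` of natural numbers with `r + s + t = n` and `s ≥ 1`. -/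
def triples (n : ℕ) : Finset (ℕ × ℕ × ℕ) :=
  {x ∈ Finset.range (n + 1) ×ˢ Finset.range (n + 1) ×ˢ Finset.range (n + 1) |
    x.1 + x.2.1 + x.2.2 = n ∧ 1 ≤ x.2.1}

theorem mem_triples {n : ℕ} {x : ℕ × ℕ × ℕ} :
    x ∈ triples n ↔ x.1 + x.2.1 + x.2.2 = n ∧ 1 ≤ x.2.1 := by
  simp only [triples, Finset.mem_filter, Finset.mem_product, Finset.mem_range]
  omega

/-- An `A_∞`-algebra over `S`.

A morphism of bimodules `m_n : A ⊗_S ⋯ ⊗_S A → A` is given by its values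
`mul [a₁, …, aₙ] = m_n (a₁ ⊗ ⋯ ⊗ aₙ)` on pure tensors; by the universal property of the tensor
product over `S` these form exactly the maps which are additive in each entry, `S`-balanced between
neighbouring entries, left `S`-linear in the first entry and right `S`-linear in the last one.
There is no operation `m_0`, so the value at the empty list is normalised to `0`. -/
structure AInfAlgebra (k : Type u₁) (S : Type u₂) [Field k] [Ring S] [Algebra k S]
    extends GrBimod.{u₁, u₂, v} k S where
  mul : List carrier → carrier
  mul_nil : mul [] = 0
  mul_add : ∀ (l₁ l₂ : List carrier) (a b : carrier),
    mul (l₁ ++ (a + b) :: l₂) = mul (l₁ ++ a :: l₂) + mul (l₁ ++ b :: l₂)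
  mul_balanced : ∀ (l₁ l₂ : List carrier) (a b : carrier) (s : S),
    mul (l₁ ++ (op s • a) :: b :: l₂) = mul (l₁ ++ a :: (s • b) :: l₂)
  mul_left : ∀ (s : S) (a : carrier) (l : List carrier), mul ((s • a) :: l) = s • mul (a :: l)
  mul_right : ∀ (s : S) (a : carrier) (l : List carrier),
    mul (l ++ [op s • a]) = op s • mul (l ++ [a])
  /-- `m_n` is homogeneous of degree `2 - n` -/
  mul_deg : ∀ (l : List carrier) (js : List ℤ), l ≠ [] → HomogList toGrMod l js →
    mul l ∈ deg (js.sum + (2 - l.length))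
  /-- `∑ (-1) ^ (r + s t) m_{r+1+t} (id^{⊗ r} ⊗ m_s ⊗ id^{⊗ t}) = 0` over `r + s + t = n`, `s ≥ 1`,
  evaluated at the pure tensor with entries `l` -/
  stasheff : ∀ l : List carrier,
    ∑ x ∈ triples l.length,
      ((x.1 : ℤ) + x.2.1 * x.2.2).negOnePow •
        mul ((l.take x.1).map (toGrMod.koszul (2 - x.2.1)) ++
          mul ((l.drop x.1).take x.2.1) :: l.drop (x.1 + x.2.1)) = 0

variable {k : Type u₁} {S : Type u₂} [Field k] [Ring S] [Algebra k S]

/-- A family `f = (f_n)_{n ≥ 1}` of morphisms of right `S`-modules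
`f_n : M ⊗_S A ⊗_S ⋯ ⊗_S A → N` (`n - 1` factors `A`), given by the values
`f x [a₁, …, aₙ₋₁] = f_n (x ⊗ a₁ ⊗ ⋯ ⊗ aₙ₋₁)` on pure tensors; by the universal property of the
tensor product over `S` these form exactly the maps which are additive in each entry, `S`-balanced
between neighbouring entries and right `S`-linear in the last entry. -/
@[ext]
structure Fam (A : GrBimod.{u₁, u₂, v} k S) (M N : GrMod.{u₂, w} S) where
  toFun : M → List A → N
  add_left' : ∀ (x y : M) (l : List A), toFun (x + y) l = toFun x l + toFun y l
  map_add' : ∀ (x : M) (l₁ l₂ : List A) (a b : A),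
    toFun x (l₁ ++ (a + b) :: l₂) = toFun x (l₁ ++ a :: l₂) + toFun x (l₁ ++ b :: l₂)
  balanced_left' : ∀ (x : M) (s : S) (a : A) (l : List A),
    toFun (op s • x) (a :: l) = toFun x ((s • a) :: l)
  balanced' : ∀ (x : M) (l₁ l₂ : List A) (a b : A) (s : S),
    toFun x (l₁ ++ (op s • a) :: b :: l₂) = toFun x (l₁ ++ a :: (s • b) :: l₂)
  right_nil' : ∀ (x : M) (s : S), toFun (op s • x) [] = op s • toFun x []
  right' : ∀ (x : M) (s : S) (a : A) (l : List A),
    toFun x (l ++ [op s • a]) = op s • toFun x (l ++ [a])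

/-- The composition of two families, where `d` is the degree of the inner family `f`:
`(g ∘ f)_n = ∑ (-1) ^ ((d + r + 1) s) g_{1+s} (f_r ⊗ id^{⊗ s})` over `r + s = n`, `r ≥ 1`, `s ≥ 0`.
The summation index is `p = (r - 1, s)`, where `r - 1` is the number of arguments from `A`
that are fed into `f_r`. -/
def compFun {A : Type v} {M N L : Type w} [AddCommGroup L] (d : ℤ)
    (g : N → List A → L) (f : M → List A → N) : M → List A → L := fun x l =>
  ∑ p ∈ Finset.HasAntidiagonal.antidiagonal l.length,
    ((d + (p.1 + 1) + 1) * p.2).negOnePow • g (f x (l.take p.1)) (l.drop p.1)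

/-- The differential of a family `f` of degree `d`:
`δ(f)_n = ∑ (-1) ^ (d + r + s t + 1) f_{r+1+t} (id^{⊗ r} ⊗ m_s ⊗ id^{⊗ t})` over `r + s + t = n`,
`r, s ≥ 1`, `t ≥ 0`.  The summation index is `y = (r - 1, s, t)`, where `r - 1` is the number of
arguments from `A` to the left of `m_s`. -/
noncomputable def diffFun (A : AInfAlgebra.{u₁, u₂, v} k S) {M : GrMod.{u₂, w} S} {N : Type w}
    [AddCommGroup N] (d : ℤ) (f : M → List A.carrier → N) : M → List A.carrier → N := fun x l =>
  ∑ y ∈ triples l.length,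
    (d + (y.1 + 1) + y.2.1 * y.2.2 + 1).negOnePow •
      f (M.koszul (2 - y.2.1) x)
        ((l.take y.1).map (A.toGrMod.koszul (2 - y.2.1)) ++
          A.mul ((l.drop y.1).take y.2.1) :: l.drop (y.1 + y.2.1))

namespace Fam

variable {A : GrBimod.{u₁, u₂, v} k S} {M N L : GrMod.{u₂, w} S}

instance : CoeFun (Fam A M N) (fun _ => M → List A → N) := ⟨toFun⟩

/-- The family has degree `d`, that is, each `f_n` is homogeneous of degree `d + 1 - n`. -/
def IsHomog (d : ℤ) (f : Fam A M N) : Prop :=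
  ∀ (x : M) (j : ℤ) (l : List A) (js : List ℤ), x ∈ M.deg j → HomogList A.toGrMod l js →
    f x l ∈ N.deg (j + js.sum + (d - l.length))

/-- A family as an additive map in its argument from `M`. -/
def addHom (f : Fam A M N) (l : List A) : M →+ N :=
  AddMonoidHom.mk' (fun x => f x l) fun x y => f.add_left' x y l

/-- A family as an additive map in one of its arguments from `A`. -/
def addHomAt (f : Fam A M N) (x : M) (l₁ l₂ : List A) : A →+ N :=
  AddMonoidHom.mk' (fun a => f x (l₁ ++ a :: l₂)) fun a b => f.map_add' x l₁ l₂ a b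

theorem map_units_smul (f : Fam A M N) (c : ℤˣ) (x : M) (l : List A) :
    f (c • x) l = c • f x l := by
  rw [Units.smul_def, Units.smul_def]; exact map_zsmul (f.addHom l) _ x

theorem map_units_smul_at (f : Fam A M N) (c : ℤˣ) (x : M) (l₁ l₂ : List A) (a : A) :
    f x (l₁ ++ (c • a) :: l₂) = c • f x (l₁ ++ a :: l₂) := by
  rw [Units.smul_def, Units.smul_def]; exact map_zsmul (f.addHomAt x l₁ l₂) _ a

theorem map_sum (f : Fam A M N) {ι : Type*} (s : Finset ι) (g : ι → M) (l : List A) :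
    f (∑ i ∈ s, g i) l = ∑ i ∈ s, f (g i) l :=
  _root_.map_sum (f.addHom l) g s

theorem map_sub (f : Fam A M N) (x y : M) (l : List A) : f (x - y) l = f x l - f y l :=
  _root_.map_sub (f.addHom l) x y

theorem map_zero (f : Fam A M N) (l : List A) : f 0 l = 0 := _root_.map_zero (f.addHom l)

theorem op_smul_units {P : GrMod.{u₂, w} S} (s : S) (c : ℤˣ) (x : P) :
    c • (op s • x) = op s • (c • x) := by
  rw [Units.smul_def, Units.smul_def, smul_comm]

/-- The composition of families is a family. -/
def comp (d : ℤ) (g : Fam A N L) (f : Fam A M N) : Fam A M L where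
  toFun := compFun d g f
  add_left' x y l := by
    simp only [compFun, f.add_left', g.add_left', smul_add, Finset.sum_add_distrib]
  map_add' x l₁ l₂ a b := by
    simp only [compFun, List.length_append, List.length_cons, ← Finset.sum_add_distrib, ← smul_add]
    refine Finset.sum_congr rfl fun p _ => ?_
    congr 1
    obtain h | ⟨i, h⟩ : p.1 ≤ l₁.length ∨ ∃ i, p.1 = l₁.length + (i + 1) := by
      by_cases h : p.1 ≤ l₁.length
      · exact Or.inl h
      · exact Or.inr ⟨p.1 - l₁.length - 1, by omega⟩
    · simp only [List.take_append_of_le_length h, List.drop_append_of_le_length h, g.map_add']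
    · simp only [h, List.take_length_add_append, List.drop_length_add_append, List.take_succ_cons,
        List.drop_succ_cons, f.map_add', g.add_left']
  balanced_left' x s a l := by
    simp only [compFun, List.length_cons]
    refine Finset.sum_congr rfl fun p _ => ?_
    congr 1
    rcases p.1 with _ | i
    · simp only [List.take_zero, List.drop_zero, f.right_nil', g.balanced_left']
    · simp only [List.take_succ_cons, List.drop_succ_cons, f.balanced_left']
  balanced' x l₁ l₂ a b s := by
    simp only [compFun, List.length_append, List.length_cons]
    refine Finset.sum_congr rfl fun p _ => ?_
    congr 1
    obtain h | h | ⟨i, h⟩ : p.1 ≤ l₁.length ∨ p.1 = l₁.length + 1 ∨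
        ∃ i, p.1 = l₁.length + (i + 2) := by
      by_cases h : p.1 ≤ l₁.length
      · exact Or.inl h
      · by_cases h' : p.1 = l₁.length + 1
        · exact Or.inr (Or.inl h')
        · exact Or.inr (Or.inr ⟨p.1 - l₁.length - 2, by omega⟩)
    · simp only [List.take_append_of_le_length h, List.drop_append_of_le_length h, g.balanced']
    · simp only [h, List.take_length_add_append, List.drop_length_add_append, List.take_succ_cons,
        List.drop_succ_cons, List.take_zero, List.drop_zero, f.right', g.balanced_left']
    · simp only [h, List.take_length_add_append, List.drop_length_add_append, List.take_succ_cons,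
        List.drop_succ_cons, f.balanced']
  right_nil' x s := by
    simp [compFun, f.right_nil', g.right_nil', op_smul_units]
  right' x s a l := by
    simp only [compFun, List.length_append, List.length_cons, List.length_nil, Finset.smul_sum]
    refine Finset.sum_congr rfl fun p hp => ?_
    rw [← op_smul_units]
    congr 1
    rw [Finset.HasAntidiagonal.mem_antidiagonal] at hp
    obtain h | h : p.1 ≤ l.length ∨ p.1 = l.length + 1 := by omega
    · simp only [List.take_append_of_le_length h, List.drop_append_of_le_length h, g.right']
    · simp only [h, List.take_length_add_append, List.drop_length_add_append, List.take_succ_cons,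
        List.drop_succ_cons, List.take_zero, List.drop_zero, f.right', g.right_nil']

end Fam

theorem HomogList.take {A : GrMod.{u₂, v} S} {l : List A} {js : List ℤ} (h : HomogList A l js)
    (n : ℕ) : HomogList A (l.take n) (js.take n) := List.forall₂_take n h

theorem HomogList.drop {A : GrMod.{u₂, v} S} {l : List A} {js : List ℤ} (h : HomogList A l js)
    (n : ℕ) : HomogList A (l.drop n) (js.drop n) := List.forall₂_drop n h

namespace Fam

variable {A : GrBimod.{u₁, u₂, v} k S} {M N L P : GrMod.{u₂, w} S}

theorem comp_homog {d e : ℤ} {g : Fam A N L} {f : Fam A M N} (hg : g.IsHomog e)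
    (hf : f.IsHomog d) : (comp d g f).IsHomog (d + e) := by
  intro x j l js hx hl
  change compFun d g f x l ∈ _
  refine Submodule.sum_mem (L.deg _) fun p hp => ?_
  rw [Finset.HasAntidiagonal.mem_antidiagonal] at hp
  rw [Units.smul_def]
  refine zsmul_mem ?_ _
  have h := hg _ _ _ _ (hf x j _ _ hx (hl.take p.1)) (hl.drop p.1)
  convert h using 2
  have hs : js.sum = (js.take p.1).sum + (js.drop p.1).sum := by
    rw [← List.sum_append, List.take_append_drop]
  rw [List.length_take, List.length_drop, hs]
  have : min p.1 l.length = p.1 := by omega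
  rw [this, Nat.cast_sub (by omega)]
  ring

/-- The composition is associative. -/
theorem compFun_assoc {d e : ℤ} (h : Fam A L P) (g : N → List A → L) (f : M → List A → N) :
    compFun d (compFun e h g) f = compFun (d + e) h (compFun d g f) := by
  funext x l
  simp only [compFun, List.length_take, List.length_drop, h.map_sum, h.map_units_smul,
    Finset.smul_sum, smul_smul, ← Int.negOnePow_add]
  rw [Finset.sum_sigma', Finset.sum_sigma']
  refine Finset.sum_nbij' (fun y => ⟨(y.1.1 + y.2.1, y.2.2), (y.1.1, y.2.1)⟩)
    (fun y => ⟨(y.2.1, y.2.2 + y.1.2), (y.2.2, y.1.2)⟩) ?_ ?_ ?_ ?_ ?_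
  · rintro ⟨⟨p, q⟩, ⟨r, s⟩⟩ hy
    simp only [Finset.mem_sigma, Finset.HasAntidiagonal.mem_antidiagonal] at hy ⊢
    omega
  · rintro ⟨⟨p, q⟩, ⟨r, s⟩⟩ hy
    simp only [Finset.mem_sigma, Finset.HasAntidiagonal.mem_antidiagonal] at hy ⊢
    omega
  · rintro ⟨⟨p, q⟩, ⟨r, s⟩⟩ hy
    simp only [Finset.mem_sigma, Finset.HasAntidiagonal.mem_antidiagonal] at hy
    obtain rfl : q = r + s := by omega
    rfl
  · rintro ⟨⟨p, q⟩, ⟨r, s⟩⟩ hy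
    simp only [Finset.mem_sigma, Finset.HasAntidiagonal.mem_antidiagonal] at hy
    obtain rfl : p = r + s := by omega
    rfl
  · rintro ⟨⟨p, q⟩, ⟨r, s⟩⟩ hy
    simp only [Finset.mem_sigma, Finset.HasAntidiagonal.mem_antidiagonal] at hy
    obtain rfl : q = r + s := by omega
    simp only
    congr 1
    · rw [Int.negOnePow_eq_iff]
      push_cast
      exact ⟨s, by ring⟩
    · rw [List.take_take, List.drop_drop, List.drop_take]
      simp

theorem compFun_add_right {d : ℤ} (g : Fam A N L) (f f' : M → List A → N) :
    compFun d g (f + f') = compFun d g f + compFun d g f' := by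
  funext x l
  simp only [compFun, Pi.add_apply, g.add_left', smul_add, Finset.sum_add_distrib]

theorem compFun_sub_right {d : ℤ} (g : Fam A N L) (f f' : M → List A → N) :
    compFun d g (f - f') = compFun d g f - compFun d g f' := by
  funext x l
  simp only [compFun, Pi.sub_apply, g.map_sub, smul_sub, Finset.sum_sub_distrib]

theorem compFun_add_left {d : ℤ} (g g' : N → List A → L) (f : M → List A → N) :
    compFun d (g + g') f = compFun d g f + compFun d g' f := by
  funext x l
  simp only [compFun, Pi.add_apply, smul_add, Finset.sum_add_distrib]

theorem compFun_sub_left {d : ℤ} (g g' : N → List A → L) (f : M → List A → N) :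
    compFun d (g - g') f = compFun d g f - compFun d g' f := by
  funext x l
  simp only [compFun, Pi.sub_apply, smul_sub, Finset.sum_sub_distrib]

theorem map_koszul_homog (f : Fam A M N) (e : ℤ) (x : M) {l : List A} {js : List ℤ}
    (hl : HomogList A.toGrMod l js) (l₁ : List A) :
    f x (l₁ ++ l.map (A.toGrMod.koszul e)) = (e * js.sum).negOnePow • f x (l₁ ++ l) := by
  induction hl generalizing l₁ with
  | nil => simp
  | @cons a j l js ha _ ih =>
    have h1 : f x (l₁ ++ A.toGrMod.koszul e a :: l.map (A.toGrMod.koszul e)) =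
        (e * j).negOnePow • f x (l₁ ++ a :: l.map (A.toGrMod.koszul e)) := by
      rw [A.toGrMod.koszul_of_mem e ha, map_units_smul_at]
    have h2 := ih (l₁ ++ [a])
    simp only [List.append_assoc, List.singleton_append] at h2
    rw [List.map_cons, h1, h2, smul_smul, ← Int.negOnePow_add, List.sum_cons, mul_add]

/-- The Koszul sign operator commutes with a homogeneous family up to the expected sign. -/
theorem koszul_map {d : ℤ} {f : Fam A M N} (hf : f.IsHomog d) (e : ℤ) (x : M) (l : List A) :
    N.koszul e (f x l) =
      (e * (d - l.length)).negOnePow • f (M.koszul e x) (l.map (A.toGrMod.koszul e)) := by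
  induction x using DirectSum.Decomposition.inductionOn M.deg with
  | zero => simp [f.map_zero]
  | add x y hx hy => simp only [f.add_left', _root_.map_add, hx, hy, smul_add]
  | @homogeneous j x =>
    have key : ∀ (l₂ l₁ : List A) (js : List ℤ), HomogList A.toGrMod l₁ js →
        N.koszul e (f x (l₁ ++ l₂)) =
          (e * (d - (l₁ ++ l₂).length)).negOnePow •
            f (M.koszul e x) ((l₁ ++ l₂).map (A.toGrMod.koszul e)) := by
      intro l₂
      induction l₂ with
      | nil =>
        intro l₁ js hl
        have h3 := f.map_koszul_homog e x hl []
        simp only [List.nil_append] at h3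
        rw [List.append_nil, N.koszul_of_mem e (hf x j l₁ js x.2 hl), M.koszul_of_mem e x.2,
          map_units_smul, h3, smul_smul, smul_smul, ← Int.negOnePow_add, ← Int.negOnePow_add]
        congr 2
        ring
      | cons a l₂ ih =>
        intro l₁ js hl
        induction a using DirectSum.Decomposition.inductionOn A.deg with
        | zero =>
          have h1 := _root_.map_zero (f.addHomAt x l₁ l₂)
          have h2 := _root_.map_zero (f.addHomAt (M.koszul e x) (l₁.map (A.toGrMod.koszul e))
            (l₂.map (A.toGrMod.koszul e)))
          simp only [addHomAt, AddMonoidHom.mk'_apply] at h1 h2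
          simp [h1, h2]
        | add a b ha hb =>
          simp only [List.map_append, List.map_cons, List.length_append, List.length_cons,
            _root_.map_add, f.map_add', smul_add] at ha hb ⊢
          rw [ha, hb]
        | @homogeneous i a =>
          have h := ih (l₁ ++ [(a : A)]) (js ++ [i])
            (List.rel_append hl (List.Forall₂.cons a.2 List.Forall₂.nil))
          simpa only [List.append_assoc, List.singleton_append] using h
    exact key l [] [] List.Forall₂.nil

end Fam

section Leibniz

variable {A : AInfAlgebra.{u₁, u₂, v} k S} {M N L : GrMod.{u₂, w} S}

/-- The graded Leibniz rule. -/
theorem diffFun_comp {d e : ℤ} (g : Fam A.toGrBimod N L) {f : Fam A.toGrBimod M N}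
    (hf : f.IsHomog d) :
    diffFun A (d + e) (compFun d g f) =
      compFun d (diffFun A e g) f + e.negOnePow • compFun (d + 1) g (diffFun A d f) := by
  funext x l
  simp only [Pi.add_apply, Pi.smul_apply, diffFun, compFun, List.length_append, List.length_map,
    List.length_cons, List.length_take, List.length_drop, Fam.koszul_map hf, g.map_sum,
    g.map_units_smul, Finset.smul_sum, smul_smul, ← Int.negOnePow_add]
  rw [Finset.sum_sigma', Finset.sum_sigma', Finset.sum_sigma',
    ← Finset.sum_filter_add_sum_filter_not _ (fun y => y.2.1 ≤ y.1.1)]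
  congr 1
  · refine Finset.sum_nbij'
      (fun y => ⟨(y.2.1, l.length - y.2.1), (y.1.1 - y.2.1, y.1.2.1, y.1.2.2)⟩)
      (fun y => ⟨(y.2.1 + y.1.1, y.2.2.1, y.2.2.2), (y.1.1, y.2.1 + y.2.2.2 + 1)⟩) ?_ ?_ ?_ ?_ ?_
    · rintro ⟨⟨r, s, t⟩, ⟨p, q⟩⟩ hy
      simp only [Finset.mem_filter, Finset.mem_sigma, mem_triples,
        Finset.HasAntidiagonal.mem_antidiagonal] at hy ⊢
      omega
    · rintro ⟨⟨p, q⟩, ⟨r, s, t⟩⟩ hy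
      simp only [Finset.mem_filter, Finset.mem_sigma, mem_triples,
        Finset.HasAntidiagonal.mem_antidiagonal] at hy ⊢
      omega
    · rintro ⟨⟨r, s, t⟩, ⟨p, q⟩⟩ hy
      simp only [Finset.mem_filter, Finset.mem_sigma, mem_triples,
        Finset.HasAntidiagonal.mem_antidiagonal] at hy
      obtain ⟨u, rfl⟩ : ∃ u, r = u + p := ⟨r - p, by omega⟩
      obtain rfl : q = u + t + 1 := by omega
      simp
    · rintro ⟨⟨p, q⟩, ⟨r, s, t⟩⟩ hy
      simp only [Finset.mem_sigma, mem_triples,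
        Finset.HasAntidiagonal.mem_antidiagonal] at hy
      obtain rfl : q = l.length - p := by omega
      simp
    · rintro ⟨⟨r, s, t⟩, ⟨p, q⟩⟩ hy
      simp only [Finset.mem_filter, Finset.mem_sigma, mem_triples,
        Finset.HasAntidiagonal.mem_antidiagonal] at hy
      obtain ⟨u, rfl⟩ : ∃ u, r = p + u := ⟨r - p, by omega⟩
      obtain rfl : q = u + t + 1 := by omega
      have hn : l.length - p = u + s + t := by omega
      have hm : min p l.length = p := by omega
      have hlen : p ≤ ((l.take (p + u)).map (A.toGrMod.koszul (2 - s))).length := by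
        simp only [List.length_map, List.length_take]; omega
      simp only [hn, hm]
      congr 1
      · rw [Int.negOnePow_eq_iff]
        push_cast
        exact ⟨d + p + 1 - s * p - s - (d - p), by rw [add_tsub_cancel_left]; ring⟩
      · rw [List.take_append_of_le_length hlen, List.drop_append_of_le_length hlen,
          ← List.map_take, ← List.map_drop, List.take_take, List.drop_take, List.drop_drop,
          List.drop_drop, List.map_take, List.map_take]
        simp [add_assoc]
  · refine Finset.sum_nbij'
      (fun y => ⟨(y.2.1 + y.1.2.1 - 1, y.2.2), (y.1.1, y.1.2.1, y.2.1 - 1 - y.1.1)⟩)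
      (fun y => ⟨(y.2.1, y.2.2.1, y.2.2.2 + y.1.2), (y.2.1 + 1 + y.2.2.2, y.1.2)⟩) ?_ ?_ ?_ ?_ ?_
    · rintro ⟨⟨r, s, t⟩, ⟨p, q⟩⟩ hy
      simp only [Finset.mem_filter, Finset.mem_sigma, mem_triples,
        Finset.HasAntidiagonal.mem_antidiagonal] at hy ⊢
      omega
    · rintro ⟨⟨p, q⟩, ⟨r, s, t⟩⟩ hy
      simp only [Finset.mem_filter, Finset.mem_sigma, mem_triples,
        Finset.HasAntidiagonal.mem_antidiagonal] at hy ⊢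
      omega
    · rintro ⟨⟨r, s, t⟩, ⟨p, q⟩⟩ hy
      simp only [Finset.mem_filter, Finset.mem_sigma, mem_triples,
        Finset.HasAntidiagonal.mem_antidiagonal] at hy
      obtain ⟨u, rfl⟩ : ∃ u, p = r + 1 + u := ⟨p - r - 1, by omega⟩
      obtain rfl : t = u + q := by omega
      simp
    · rintro ⟨⟨p, q⟩, ⟨r, s, t⟩⟩ hy
      simp only [Finset.mem_sigma, mem_triples,
        Finset.HasAntidiagonal.mem_antidiagonal] at hy
      obtain rfl : p = r + s + t := by omega
      have h2 : r + 1 + t + s - 1 = r + s + t := by omega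
      simp [h2]
    · rintro ⟨⟨r, s, t⟩, ⟨p, q⟩⟩ hy
      simp only [Finset.mem_filter, Finset.mem_sigma, mem_triples,
        Finset.HasAntidiagonal.mem_antidiagonal] at hy
      obtain ⟨u, rfl⟩ : ∃ u, p = r + (1 + u) := ⟨p - r - 1, by omega⟩
      obtain rfl : t = u + q := by omega
      obtain ⟨v, rfl⟩ : ∃ v, s = v + 1 := ⟨s - 1, by omega⟩
      have h1 : r + (1 + u) - 1 - r = u := by omega
      have h2 : r + (1 + u) + (v + 1) - 1 = r + (v + 1) + u := by omega
      have hlen : ((l.take r).map (A.toGrMod.koszul (2 - ((v + 1 : ℕ) : ℤ)))).length = r := by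
        simp only [List.length_map, List.length_take]; omega
      simp only [h1, h2]
      congr 1
      · rw [Int.negOnePow_eq_iff]
        push_cast
        exact ⟨0, by ring⟩
      · have key : ∀ w : List A.carrier,
            (((l.take r).map (A.toGrMod.koszul (2 - ((v + 1 : ℕ) : ℤ)))) ++ w).take (r + (1 + u)) =
              ((l.take r).map (A.toGrMod.koszul (2 - ((v + 1 : ℕ) : ℤ)))) ++ w.take (1 + u) ∧
            (((l.take r).map (A.toGrMod.koszul (2 - ((v + 1 : ℕ) : ℤ)))) ++ w).drop (r + (1 + u)) =
              w.drop (1 + u) := by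
          intro w
          have h3 := List.take_length_add_append (l₁ := (l.take r).map (A.toGrMod.koszul (2 - ((v + 1 : ℕ) : ℤ)))) (l₂ := w) (1 + u)
          have h4 := List.drop_length_add_append (l₁ := (l.take r).map (A.toGrMod.koszul (2 - ((v + 1 : ℕ) : ℤ)))) (l₂ := w) (1 + u)
          rw [hlen] at h3 h4
          exact ⟨h3, h4⟩
        rw [(key _).1, (key _).2, add_comm 1 u, List.take_succ_cons, List.drop_succ_cons,
          List.take_take, List.drop_take, List.drop_take, List.take_take, List.drop_drop]
        have e1 : min r (r + (v + 1) + u) = r := by omega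
        have e2 : min (v + 1) (r + (v + 1) + u - r) = v + 1 := by omega
        have e3 : r + (v + 1) + u - (r + (v + 1)) = u := by omega
        rw [e1, e2, e3]

end Leibniz

/-- A right `A_∞`-module over `A`: a graded right `S`-module with a family of operations
`m_n : M ⊗ A^{⊗ (n-1)} → M`, homogeneous of degree `2 - n`, such that
`∑ (-1) ^ (r + s t) m_{r+1+t} (id^{⊗ r} ⊗ m_s ⊗ id^{⊗ t})
  + ∑ (-1) ^ (s t) m_{1+t} (m_s ⊗ id^{⊗ t}) = 0`. -/
structure AInfModule (A : AInfAlgebra.{u₁, u₂, v} k S) extends GrMod.{u₂, w} S where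
  act : Fam A.toGrBimod toGrMod toGrMod
  act_homog : act.IsHomog 1
  act_rel : diffFun A 1 act + compFun 1 act act = 0

variable {A : AInfAlgebra.{u₁, u₂, v} k S}

namespace AInfModule

/-- A morphism of right `A_∞`-modules: a family of morphisms `f_n : M ⊗ A^{⊗ (n-1)} → N`,
homogeneous of degree `1 - n`, such that
`∑ (-1) ^ (r + s t) f_{r+1+t} (id^{⊗ r} ⊗ m_s ⊗ id^{⊗ t}) + ∑ (-1) ^ (s t) f_{1+t} (m_s ⊗ id^{⊗ t})
  - ∑ (-1) ^ ((r + 1) s) m_{1+s} (f_r ⊗ id^{⊗ s}) = 0` (`rel` is this relation multiplied by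
`-1`: the first sum is minus the differential of the degree `0` family `f`). -/
@[ext]
structure Hom (M N : AInfModule.{u₁, u₂, v, w} A) where
  fam : Fam A.toGrBimod M.toGrMod N.toGrMod
  homog : fam.IsHomog 0
  rel : diffFun A 0 fam + compFun 0 N.act fam - compFun 1 fam M.act = 0

end AInfModule

namespace Fam

/-- The identity family: `f_1 = id` and `f_n = 0` for `n ≥ 2`. -/
def one (A : GrBimod.{u₁, u₂, v} k S) (M : GrMod.{u₂, w} S) : Fam A M M where
  toFun x l := match l with
    | [] => x
    | _ :: _ => 0
  add_left' x y l := by cases l <;> simp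
  map_add' x l₁ l₂ a b := by cases l₁ <;> simp
  balanced_left' x s a l := rfl
  balanced' x l₁ l₂ a b s := by cases l₁ <;> simp
  right_nil' x s := rfl
  right' x s a l := by cases l <;> simp

/-- The zero family. -/
def zero (A : GrBimod.{u₁, u₂, v} k S) (M N : GrMod.{u₂, w} S) : Fam A M N where
  toFun _ _ := 0
  add_left' x y l := by simp
  map_add' x l₁ l₂ a b := by simp
  balanced_left' x s a l := rfl
  balanced' x l₁ l₂ a b s := rfl
  right_nil' x s := by simp
  right' x s a l := by simp

/-- The difference of two families. -/
def sub {A : GrBimod.{u₁, u₂, v} k S} {M N : GrMod.{u₂, w} S} (f g : Fam A M N) : Fam A M N where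
  toFun x l := f x l - g x l
  add_left' x y l := by simp only [f.add_left', g.add_left']; abel
  map_add' x l₁ l₂ a b := by simp only [f.map_add', g.map_add']; abel
  balanced_left' x s a l := by simp only [f.balanced_left', g.balanced_left']
  balanced' x l₁ l₂ a b s := by simp only [f.balanced', g.balanced']
  right_nil' x s := by simp only [f.right_nil', g.right_nil', smul_sub]
  right' x s a l := by simp only [f.right', g.right', smul_sub]

variable {A' : GrBimod.{u₁, u₂, v} k S} {M N L : GrMod.{u₂, w} S}

theorem one_homog : (one A' M).IsHomog 0 := by
  intro x j l js hx hl
  cases hl with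
  | nil => simpa [one] using hx
  | cons _ _ => exact Submodule.zero_mem (M.deg _)

theorem zero_homog (d : ℤ) : (zero A' M N).IsHomog d :=
  fun _ _ _ _ _ _ => Submodule.zero_mem (N.deg _)

theorem sub_homog {d : ℤ} {f g : Fam A' M N} (hf : f.IsHomog d) (hg : g.IsHomog d) :
    (f.sub g).IsHomog d :=
  fun x j l js hx hl => Submodule.sub_mem (N.deg _) (hf x j l js hx hl) (hg x j l js hx hl)

theorem compFun_one_left (d : ℤ) (f : M → List A' → N) : compFun d (one A' N) f = f := by
  funext x l
  rw [compFun, Finset.sum_eq_single (l.length, 0)]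
  · simp [one]
  · rintro ⟨p, q⟩ hp hne
    rw [Finset.HasAntidiagonal.mem_antidiagonal] at hp
    simp only at hp
    have hq : q ≠ 0 := by
      rintro rfl
      exact hne (by simp [← hp])
    have : (l.drop p).length ≠ 0 := by simp only [List.length_drop]; omega
    cases h : l.drop p with
    | nil => simp [h] at this
    | cons a l' => simp [one]
  · simp

theorem compFun_one_right (g : Fam A' M N) : compFun 0 g (one A' M) = g.toFun := by
  funext x l
  rw [compFun, Finset.sum_eq_single (0, l.length)]
  · have : (((0 : ℤ) + (((0, l.length) : ℕ × ℕ).1 + 1) + 1) * ((0, l.length) : ℕ × ℕ).2) =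
        2 * (l.length : ℤ) := by push_cast; ring
    rw [this, Int.negOnePow_two_mul]
    simp [one]
  · rintro ⟨p, q⟩ hp hne
    rw [Finset.HasAntidiagonal.mem_antidiagonal] at hp
    simp only at hp
    have hq : p ≠ 0 := by
      rintro rfl
      exact hne (by simp [← hp])
    have : (l.take p).length ≠ 0 := by simp only [List.length_take]; omega
    cases h : l.take p with
    | nil => simp [h] at this
    | cons a l' => simp [one, g.map_zero]
  · simp

theorem diffFun_one (d : ℤ) (M : GrMod.{u₂, w} S) :
    diffFun A d (one A.toGrBimod M) = 0 := by
  funext x l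
  refine Finset.sum_eq_zero fun y _ => ?_
  cases (l.take y.1).map (A.toGrMod.koszul (2 - y.2.1)) <;> simp [one]

/-- The first component `f_1 : M → N` of a family, as a morphism of right `S`-modules. -/
def first (f : Fam A' M N) : M →ₗ[Sᵐᵒᵖ] N where
  toFun x := f x []
  map_add' x y := f.add_left' x y []
  map_smul' s x := f.right_nil' x s.unop

theorem first_mem {f : Fam A' M N} {d : ℤ} (hf : f.IsHomog d) {j j' : ℤ} (hj : j + d = j') (x : M)
    (hx : x ∈ M.deg j) : f.first x ∈ N.deg j' := by
  have h := hf x j [] [] hx List.Forall₂.nil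
  subst hj
  change f x [] ∈ _
  simpa using h

end Fam

theorem diffFun_sub {d : ℤ} {M : GrMod.{u₂, w} S} {N : Type w} [AddCommGroup N]
    (f g : M → List A.carrier → N) : diffFun A d (f - g) = diffFun A d f - diffFun A d g := by
  funext x l
  simp only [diffFun, Pi.sub_apply, smul_sub, Finset.sum_sub_distrib]

namespace AInfModule

theorem Hom.diff_eq {M N : AInfModule.{u₁, u₂, v, w} A} (f : Hom M N) :
    diffFun A 0 f.fam = compFun 1 f.fam M.act - compFun 0 N.act f.fam := by
  have := f.rel
  rw [add_sub_assoc] at this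
  rw [eq_neg_of_add_eq_zero_left this, neg_sub]

/-- The category `Mod_∞-A` of right `A_∞`-modules over `A`. -/
instance : Category (AInfModule.{u₁, u₂, v, w} A) where
  Hom := Hom
  id M :=
    { fam := Fam.one A.toGrBimod M.toGrMod
      homog := Fam.one_homog
      rel := by
        rw [Fam.diffFun_one, Fam.compFun_one_left, Fam.compFun_one_right]
        simp }
  comp {M N L} f g :=
    { fam := Fam.comp 0 g.fam f.fam
      homog := Fam.comp_homog g.homog f.homog
      rel := by
        change diffFun A 0 (compFun 0 g.fam f.fam) + compFun 0 L.act (compFun 0 g.fam f.fam) -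
          compFun 1 (compFun 0 g.fam f.fam) M.act = 0
        have h := diffFun_comp (d := 0) (e := 0) g.fam f.homog
        simp only [add_zero, zero_add, Int.negOnePow_zero, one_smul] at h
        have a1 := Fam.compFun_assoc (d := 0) (e := 1) g.fam N.act f.fam
        have a2 := Fam.compFun_assoc (d := 0) (e := 0) L.act g.fam f.fam
        have a3 := Fam.compFun_assoc (d := 1) (e := 0) g.fam f.fam M.act
        simp only [add_zero, zero_add] at a1 a2 a3
        rw [h, f.diff_eq, g.diff_eq, Fam.compFun_sub_left, Fam.compFun_sub_right, a1, a2, a3]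
        abel }
  id_comp f := Hom.ext (Fam.ext (Fam.compFun_one_right f.fam))
  comp_id f := Hom.ext (Fam.ext (Fam.compFun_one_left 0 f.fam))
  assoc f g h := Hom.ext (Fam.ext
    (Fam.compFun_assoc (d := 0) (e := 0) h.fam g.fam f.fam).symm)

/-- `f` and `g` are homotopic: there is a family `h_n : M ⊗ A^{⊗ (n-1)} → N`, homogeneous of degree
`-n`, such that `f_n - g_n` is the sum of
`∑ (-1) ^ (r + s t) h_{r+1+t} (id^{⊗ r} ⊗ m_s ⊗ id^{⊗ t})`,
`∑ (-1) ^ (r s) m_{1+s} (h_r ⊗ id^{⊗ s})` and `∑ (-1) ^ (s t) h_{1+t} (m_s ⊗ id^{⊗ t})`. -/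
def Homotopic : HomRel (AInfModule.{u₁, u₂, v, w} A) := fun M N f g =>
  ∃ h : Fam A.toGrBimod M.toGrMod N.toGrMod, h.IsHomog (-1) ∧
    f.fam.toFun - g.fam.toFun =
      diffFun A (-1) h + compFun (-1) N.act h + compFun 1 h M.act

theorem homotopic_refl {M N : AInfModule.{u₁, u₂, v, w} A} (f : M ⟶ N) : Homotopic f f :=
  ⟨Fam.zero _ _ _, Fam.zero_homog _, by
    funext x l
    simp [diffFun, compFun, Fam.zero, N.act.map_zero]⟩

/-- Differences of homotopies are homotopies. -/
theorem homotopic_sub {M N : AInfModule.{u₁, u₂, v, w} A} {f g f' g' p q : M ⟶ N}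
    (h : Homotopic f g) (h' : Homotopic f' g')
    (e : p.fam.toFun - q.fam.toFun =
      (f.fam.toFun - g.fam.toFun) - (f'.fam.toFun - g'.fam.toFun)) : Homotopic p q := by
  obtain ⟨h, hh, he⟩ := h
  obtain ⟨h', hh', he'⟩ := h'
  refine ⟨h.sub h', Fam.sub_homog hh hh', ?_⟩
  change _ = diffFun A (-1) (h.toFun - h'.toFun) + compFun (-1) N.act (h.toFun - h'.toFun) +
    compFun 1 (h.toFun - h'.toFun) M.act
  rw [e, he, he', diffFun_sub, Fam.compFun_sub_right, Fam.compFun_sub_left]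
  abel

theorem homotopic_symm {M N : AInfModule.{u₁, u₂, v, w} A} {f g : M ⟶ N} (h : Homotopic f g) :
    Homotopic g f :=
  homotopic_sub (homotopic_refl f) h (by abel)

theorem homotopic_trans {M N : AInfModule.{u₁, u₂, v, w} A} {f g e : M ⟶ N}
    (h : Homotopic f g) (h' : Homotopic g e) : Homotopic f e :=
  homotopic_sub h (homotopic_symm h') (by abel)

theorem homotopic_precomp {M N L : AInfModule.{u₁, u₂, v, w} A} (f : M ⟶ N) {g g' : N ⟶ L}
    (h : Homotopic g g') : Homotopic (f ≫ g) (f ≫ g') := by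
  obtain ⟨h, hh, he⟩ := h
  refine ⟨Fam.comp 0 h f.fam, by simpa using Fam.comp_homog hh f.homog, ?_⟩
  change compFun 0 g.fam f.fam - compFun 0 g'.fam f.fam =
    diffFun A (-1) (compFun 0 h f.fam) + compFun (-1) L.act (compFun 0 h f.fam) +
      compFun 1 (compFun 0 h f.fam) M.act
  have hl := diffFun_comp (d := 0) (e := -1) h f.homog
  have a1 := Fam.compFun_assoc (d := 0) (e := 1) h N.act f.fam
  have a2 := Fam.compFun_assoc (d := 0) (e := -1) L.act h f.fam
  have a3 := Fam.compFun_assoc (d := 1) (e := 0) h f.fam M.act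
  simp only [add_zero, zero_add] at a1 a2 a3 hl
  rw [← Fam.compFun_sub_left, he, hl, f.diff_eq, Fam.compFun_add_left, Fam.compFun_add_left,
    Fam.compFun_sub_right, a1, a2, a3]
  simp only [Int.negOnePow_neg, Int.negOnePow_one, Units.neg_smul, one_smul]
  abel

theorem homotopic_postcomp {M N L : AInfModule.{u₁, u₂, v, w} A} {f f' : M ⟶ N} (g : N ⟶ L)
    (h : Homotopic f f') : Homotopic (f ≫ g) (f' ≫ g) := by
  obtain ⟨h, hh, he⟩ := h
  refine ⟨Fam.comp (-1) g.fam h, by simpa using Fam.comp_homog g.homog hh, ?_⟩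
  change compFun 0 g.fam f.fam - compFun 0 g.fam f'.fam =
    diffFun A (-1) (compFun (-1) g.fam h) + compFun (-1) L.act (compFun (-1) g.fam h) +
      compFun 1 (compFun (-1) g.fam h) M.act
  have hl := diffFun_comp (d := -1) (e := 0) g.fam hh
  have a1 := Fam.compFun_assoc (d := -1) (e := 1) g.fam N.act h
  have a2 := Fam.compFun_assoc (d := -1) (e := 0) L.act g.fam h
  have a3 := Fam.compFun_assoc (d := 1) (e := -1) g.fam h M.act
  simp only [add_zero, neg_add_cancel, add_neg_cancel] at a1 a2 a3 hl
  rw [← Fam.compFun_sub_right, he, hl, g.diff_eq, Fam.compFun_add_right, Fam.compFun_add_right,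
    Fam.compFun_sub_left, a1, a2, a3]
  simp only [Int.negOnePow_zero, one_smul]
  abel

/-- Homotopy is an equivalence relation which is compatible with composition. -/
instance : Congruence (Homotopic (A := A)) where
  equivalence := ⟨homotopic_refl, homotopic_symm, homotopic_trans⟩
  comp_left f _ _ h := homotopic_precomp f h
  comp_right g h := homotopic_postcomp g h

/-- The homotopy category of `Mod_∞-A`: its morphisms are the homotopy classes of morphisms. -/
abbrev HomotopyCat (A : AInfAlgebra.{u₁, u₂, v} k S) :=
  CategoryTheory.Quotient (Homotopic.{u₁, u₂, v, w} (A := A))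

/-- The canonical functor from `Mod_∞-A` to its homotopy category. -/
abbrev toHomotopyCat (A : AInfAlgebra.{u₁, u₂, v} k S) :
    AInfModule.{u₁, u₂, v, w} A ⥤ HomotopyCat.{u₁, u₂, v, w} A :=
  CategoryTheory.Quotient.functor _

/-- `f : M ⟶ N` is a homotopy equivalence: it has an inverse up to homotopy. -/
def IsHomotopyEquiv {M N : AInfModule.{u₁, u₂, v, w} A} (f : M ⟶ N) : Prop :=
  ∃ g : N ⟶ M, Homotopic (f ≫ g) (𝟙 M) ∧ Homotopic (g ≫ f) (𝟙 N)

theorem act_first_first (M : AInfModule.{u₁, u₂, v, w} A) (x : M.toGrMod) :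
    M.act.first (M.act.first x) = 0 := by
  have h := congrFun (congrFun M.act_rel x) []
  have ht : triples 0 = ∅ := by
    ext y
    simp only [mem_triples, Finset.notMem_empty, iff_false]
    omega
  change M.act (M.act x []) [] = 0
  simpa [diffFun, compFun, ht] using h

theorem Hom.first_comm {M N : AInfModule.{u₁, u₂, v, w} A} (f : Hom M N) (x : M.toGrMod) :
    N.act.first (f.fam.first x) = f.fam.first (M.act.first x) := by
  have h := congrFun (congrFun f.rel x) []
  have ht : triples 0 = ∅ := by
    ext y
    simp only [mem_triples, Finset.notMem_empty, iff_false]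
    omega
  change N.act (f.fam x []) [] = f.fam (M.act x []) []
  simpa [diffFun, compFun, ht, sub_eq_zero] using h

/-- The differential `m_1 : M_i → M_j`, `j = i + 1`. -/
def differential (M : AInfModule.{u₁, u₂, v, w} A) {i j : ℤ} (h : i + 1 = j) :
    M.deg i →ₗ[Sᵐᵒᵖ] M.deg j :=
  M.act.first.restrict (Fam.first_mem M.act_homog h)

theorem differential_comp (M : AInfModule.{u₁, u₂, v, w} A) {i j l : ℤ} (h : i + 1 = j)
    (h' : j + 1 = l) : M.differential h' ∘ₗ M.differential h = 0 :=
  LinearMap.ext fun x => Subtype.ext (M.act_first_first x)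

/-- The underlying complex `(M, m_1)` of right `S`-modules of an `A_∞`-module. -/
noncomputable def complex (M : AInfModule.{u₁, u₂, v, w} A) :
    CochainComplex (ModuleCat.{w} Sᵐᵒᵖ) ℤ where
  X i := ModuleCat.of Sᵐᵒᵖ (M.deg i)
  d i j := if h : i + 1 = j then
      ModuleCat.ofHom (M.differential h)
    else 0
  shape i j h := dif_neg h
  d_comp_d' i j l hij hjl := by
    have hij' : i + 1 = j := hij
    have hjl' : j + 1 = l := hjl
    rw [dif_pos hij', dif_pos hjl', ← ModuleCat.ofHom_comp, M.differential_comp]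
    rfl

/-- The component `M_i → N_i` of `f_1`. -/
def Hom.firstAt {M N : AInfModule.{u₁, u₂, v, w} A} (f : Hom M N) (i : ℤ) :
    M.deg i →ₗ[Sᵐᵒᵖ] N.deg i :=
  f.fam.first.restrict (Fam.first_mem f.homog (add_zero i))

theorem Hom.firstAt_comm {M N : AInfModule.{u₁, u₂, v, w} A} (f : Hom M N) {i j : ℤ}
    (h : i + 1 = j) :
    N.differential h ∘ₗ f.firstAt i = f.firstAt j ∘ₗ M.differential h :=
  LinearMap.ext fun x => Subtype.ext (f.first_comm x)

/-- The first component `f_1 : (M, m_1) → (N, m_1)` of a morphism of `A_∞`-modules, as a morphism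
of complexes of right `S`-modules. -/
noncomputable def Hom.firstComplex {M N : AInfModule.{u₁, u₂, v, w} A} (f : M ⟶ N) :
    M.complex ⟶ N.complex where
  f i := ModuleCat.ofHom (Hom.firstAt f i)
  comm' i j hij := by
    have hij' : i + 1 = j := hij
    simp only [complex]
    rw [dif_pos hij', dif_pos hij', ← ModuleCat.ofHom_comp, ← ModuleCat.ofHom_comp,
      Hom.firstAt_comm]

/-- A morphism of `A_∞`-modules is a quasi-isomorphism if its first component is a
quasi-isomorphism of complexes. -/
def IsQuasiIso {M N : AInfModule.{u₁, u₂, v, w} A} (f : M ⟶ N) : Prop :=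
  QuasiIso (Hom.firstComplex f)

end AInfModule
end AInf

/-! ### Koszul signs and the differential of a family -/

namespace AInf

namespace GrMod

variable {S : Type u₂} [Ring S]

/-! Families between two modules form a complex under `homDiff` (`homDiff_homDiff`). Its closed
elements of degree 0 are the morphisms, and its boundaries of degree 0 are the differences of
homotopic morphisms. A homotopy right inverse of `f` is therefore a pair `(g, h)` with `∂(g, h) =
(0, 1)`, where `∂(g, h) = (δ g, f g - δ h)` is the differential of the cone of composition with `f`.

Since `f_1` is a quasi-isomorphism, its cone is an acyclic complex of right `S`-modules
(`IsQuasiIso.coneAcyclic`). As `S` is semisimple, this cone has an `S`-linear contraction `s`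
(`exists_contraction`, `ConeAcyclic.nonempty_contraction`). This is the only place where the shape
of `S` matters.

The pair `(g, h)` is built by obstruction theory on the number of arguments from `A`. The defect `D
= (0, 1) - ∂(g, h)` satisfies `∂ D = 0`. Suppose that it vanishes on lists shorter than `p`. On
lists of length at most `p`, only the operations `m_1` and the component `f_1` then act on the
values of `D` and of `s D`, so the contraction identity gives `D - ∂ s D = s ∂ D = 0` there.
Replacing `(g, h)` by `(g, h) + s D` thus pushes the defect one length further (`defect₁_improve`,
`defect₂_improve`). The corrections do not alter values on shorter lists, so the iteration started
at `0` converges (`exists_right_inverse`).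

Finally, the right inverse `g` again has an acyclic cone (`ConeAcyclic.of_right_inverse`), so it has
a right inverse as well. A map with both a left and a right inverse up to homotopy is a homotopy
equivalence. -/

theorem koszul_mem (M : GrMod.{u₂, w} S) (d : ℤ) {j : ℤ} {x : M} (hx : x ∈ M.deg j) :
    M.koszul d x ∈ M.deg j := by
  rw [M.koszul_of_mem d hx, Units.smul_def]
  exact zsmul_mem hx _

theorem koszul_koszul (M : GrMod.{u₂, w} S) (d e : ℤ) (x : M) :
    M.koszul d (M.koszul e x) = M.koszul (d + e) x := by
  induction x using DirectSum.Decomposition.inductionOn M.deg with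
  | zero => simp
  | add x y hx hy => simp only [map_add, hx, hy]
  | @homogeneous j x =>
    rw [M.koszul_of_mem e x.2, M.koszul_of_mem _ x.2, Units.smul_def, map_zsmul,
      M.koszul_of_mem d x.2, ← Units.smul_def, smul_smul, ← Int.negOnePow_add]
    congr 2
    ring

end GrMod

variable {k : Type u₁} {S : Type u₂} [Field k] [Ring S] [Algebra k S]

theorem GrBimod.koszul_smul (A : GrBimod.{u₁, u₂, v} k S) (d : ℤ) (s : S) (a : A) :
    A.toGrMod.koszul d (s • a) = s • A.toGrMod.koszul d a := by
  induction a using DirectSum.Decomposition.inductionOn A.deg with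
  | zero => simp
  | add x y hx hy => simp only [map_add, smul_add, hx, hy]
  | @homogeneous j x =>
    rw [A.toGrMod.koszul_of_mem d x.2, A.toGrMod.koszul_of_mem d (A.left_mem s j _ x.2),
      Units.smul_def, Units.smul_def, smul_comm]

theorem HomogList.map_koszul {M : GrMod.{u₂, v} S} {l : List M} {js : List ℤ}
    (h : HomogList M l js) (d : ℤ) : HomogList M (l.map (M.koszul d)) js := by
  induction h with
  | nil => exact List.Forall₂.nil
  | cons ha _ ih => exact List.Forall₂.cons (M.koszul_mem d ha) ih

namespace AInfAlgebra

variable (A : AInfAlgebra.{u₁, u₂, v} k S)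

/-- The operations of `A` as a family: `A` as a right module over itself. -/
def mulFam : Fam A.toGrBimod A.toGrMod A.toGrMod where
  toFun a l := A.mul (a :: l)
  add_left' x y l := A.mul_add [] l x y
  map_add' x l₁ l₂ a b := A.mul_add (x :: l₁) l₂ a b
  balanced_left' x s a l := A.mul_balanced [] l x a s
  balanced' x l₁ l₂ a b s := A.mul_balanced (x :: l₁) l₂ a b s
  right_nil' x s := A.mul_right s x []
  right' x s a l := A.mul_right s a (x :: l)

theorem mulFam_homog : A.mulFam.IsHomog 1 := by
  intro x j l js hx hl
  have h := A.mul_deg (x :: l) (j :: js) (List.cons_ne_nil _ _) (List.Forall₂.cons hx hl)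
  change A.mul (x :: l) ∈ _
  convert h using 2
  simp only [List.sum_cons, List.length_cons]
  push_cast
  ring

/-- Viewing `A` as a right module over itself turns this into the sign rule `Fam.koszul_map` for the
degree 1 family `mulFam`. -/
theorem koszul_mul (e : ℤ) (l : List A.carrier) :
    A.toGrMod.koszul e (A.mul l) =
      (e * (2 - l.length)).negOnePow • A.mul (l.map (A.toGrMod.koszul e)) := by
  cases l with
  | nil => simp [A.mul_nil]
  | cons a l =>
    have h := Fam.koszul_map A.mulFam_homog e a l
    change A.toGrMod.koszul e (A.mul (a :: l)) = _ • A.mul (_ :: _) at h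
    rw [h, List.map_cons, List.length_cons]
    congr 3
    push_cast
    ring

end AInfAlgebra

namespace Fam

section

variable {A : GrBimod.{u₁, u₂, v} k S} {M N L : GrMod.{u₂, w} S}

theorem map_zero_at (f : Fam A M N) (x : M) (l₁ l₂ : List A) : f x (l₁ ++ 0 :: l₂) = 0 :=
  _root_.map_zero (f.addHomAt x l₁ l₂)

theorem map_sum_at (f : Fam A M N) {ι : Type*} (s : Finset ι) (g : ι → A) (x : M)
    (l₁ l₂ : List A) :
    f x (l₁ ++ (∑ i ∈ s, g i) :: l₂) = ∑ i ∈ s, f x (l₁ ++ g i :: l₂) :=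
  _root_.map_sum (f.addHomAt x l₁ l₂) g s

end

section

variable {A : AInfAlgebra.{u₁, u₂, v} k S} {M N : GrMod.{u₂, w} S}

/-- The differential of a family is a family. -/
noncomputable def diff (d : ℤ) (f : Fam A.toGrBimod M N) : Fam A.toGrBimod M N where
  toFun := diffFun A d f
  add_left' x y l := by
    simp only [diffFun, map_add, f.add_left', smul_add, Finset.sum_add_distrib]
  map_add' x l₁ l₂ a b := by
    simp only [diffFun, List.length_append, List.length_cons, ← Finset.sum_add_distrib, ← smul_add]
    refine Finset.sum_congr rfl fun ⟨r, s, t⟩ hy => ?_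
    simp only [mem_triples] at hy ⊢
    congr 1
    -- The distinguished entry lies to the left of the block fed into `m_s`, inside it, or to its
    -- right.
    obtain ⟨i, rfl⟩ | ⟨i, j, h, rfl⟩ | ⟨i, h⟩ : (∃ i, r = l₁.length + (i + 1)) ∨
        (∃ i j, l₁.length = r + i ∧ s = i + (j + 1)) ∨ (∃ i, l₁.length = r + (s + i)) := by
      by_cases h : l₁.length < r
      · exact Or.inl ⟨r - l₁.length - 1, by omega⟩
      · by_cases h' : l₁.length < r + s
        · exact Or.inr (Or.inl ⟨l₁.length - r, r + s - l₁.length - 1, by omega, by omega⟩)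
        · exact Or.inr (Or.inr ⟨l₁.length - r - s, by omega⟩)
    · simp only [List.take_length_add_append, List.drop_length_add_append, List.take_succ_cons,
        List.drop_succ_cons, List.map_append, List.map_cons, map_add, List.append_assoc,
        List.cons_append, f.map_add', add_assoc, add_comm 1 s]
      simp only [← add_assoc, List.drop_succ_cons]
    · obtain ⟨p, q, rfl, rfl⟩ : ∃ p q, l₁ = p ++ q ∧ r = p.length :=
        ⟨l₁.take r, l₁.drop r, by simp, by simp [h]⟩
      obtain rfl : i = q.length := by simpa using h.symm
      simp [List.take_length_add_append, List.drop_length_add_append, A.mul_add, f.map_add']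
    · obtain ⟨p, q, u, rfl, rfl, rfl⟩ : ∃ p q u, l₁ = p ++ (q ++ u) ∧ r = p.length ∧
          s = q.length :=
        ⟨l₁.take r, (l₁.drop r).take s, (l₁.drop r).drop s, by simp, by simp [h], by simp [h]⟩
      have := f.map_add' (M.koszul (2 - q.length) x)
        (p.map (A.toGrMod.koszul (2 - q.length)) ++ A.mul q :: u) l₂ a b
      simpa [List.take_length_add_append, List.drop_length_add_append, add_assoc] using this
  balanced_left' x s a l := by
    simp only [diffFun, List.length_cons]
    refine Finset.sum_congr rfl fun ⟨r, n, t⟩ hy => ?_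
    simp only [mem_triples] at hy ⊢
    congr 1
    obtain ⟨n, rfl⟩ : ∃ m, n = m + 1 := ⟨n - 1, by omega⟩
    rcases r with _ | r
    · simp [f.balanced_left', A.mul_left]
    · have e : r + 1 + (n + 1) = (r + (n + 1)) + 1 := by omega
      simp [f.balanced_left', GrBimod.koszul_smul, e]
  balanced' x l₁ l₂ a b s := by
    simp only [diffFun, List.length_append, List.length_cons]
    refine Finset.sum_congr rfl fun ⟨r, n, t⟩ hy => ?_
    simp only [mem_triples] at hy ⊢
    congr 1
    -- The two neighbours are both left of the block, straddle its left end, are both inside,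
    -- straddle its right end, or are both right of it. At the two ends, the left and right
    -- linearity of the operations of `A` carry the scalar across.
    obtain ⟨i, rfl⟩ | rfl | ⟨i, j, h, rfl⟩ | ⟨i, h, rfl⟩ | ⟨i, h⟩ :
        (∃ i, r = l₁.length + (i + 2)) ∨ r = l₁.length + 1 ∨
        (∃ i j, l₁.length = r + i ∧ n = i + (j + 2)) ∨ (∃ i, l₁.length = r + i ∧ n = i + 1) ∨
        (∃ i, l₁.length = r + (n + i)) := by
      by_cases h : l₁.length + 1 < r
      · exact Or.inl ⟨r - l₁.length - 2, by omega⟩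
      by_cases h₁ : r = l₁.length + 1
      · exact Or.inr (Or.inl h₁)
      by_cases h₂ : l₁.length + 1 < r + n
      · exact Or.inr (Or.inr (Or.inl ⟨l₁.length - r, r + n - l₁.length - 2, by omega, by omega⟩))
      by_cases h₃ : l₁.length + 1 = r + n
      · exact Or.inr (Or.inr (Or.inr (Or.inl ⟨l₁.length - r, by omega, by omega⟩)))
      · exact Or.inr (Or.inr (Or.inr (Or.inr ⟨l₁.length - r - n, by omega⟩)))
    · have e : l₁.length + (i + 2) + n = l₁.length + (i + n + 2) := by omega
      simp [e, List.take_length_add_append, List.drop_length_add_append, GrBimod.koszul_smul,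
        f.balanced']
    · obtain ⟨n, rfl⟩ : ∃ m, n = m + 1 := ⟨n - 1, by omega⟩
      have e : l₁.length + 1 + (n + 1) = l₁.length + (n + 2) := by omega
      simp [e, List.take_length_add_append, List.drop_length_add_append, A.mul_left, f.balanced']
    · obtain ⟨p, q, rfl, rfl⟩ : ∃ p q, l₁ = p ++ q ∧ r = p.length :=
        ⟨l₁.take r, l₁.drop r, by simp, by simp [h]⟩
      obtain rfl : i = q.length := by simpa using h.symm
      simp [List.take_length_add_append, List.drop_length_add_append, A.mul_balanced]
    · obtain ⟨p, q, rfl, rfl⟩ : ∃ p q, l₁ = p ++ q ∧ r = p.length :=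
        ⟨l₁.take r, l₁.drop r, by simp, by simp [h]⟩
      obtain rfl : i = q.length := by simpa using h.symm
      simp [List.take_length_add_append, List.drop_length_add_append, A.mul_right, f.balanced']
    · obtain ⟨p, q, u, rfl, rfl, rfl⟩ : ∃ p q u, l₁ = p ++ (q ++ u) ∧ r = p.length ∧
          n = q.length :=
        ⟨l₁.take r, (l₁.drop r).take n, (l₁.drop r).drop n, by simp, by simp [h], by simp [h]⟩
      have := f.balanced' (M.koszul (2 - q.length) x)
        (p.map (A.toGrMod.koszul (2 - q.length)) ++ A.mul q :: u) l₂ a b s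
      simpa [List.take_length_add_append, List.drop_length_add_append] using this
  right_nil' x s := by
    have ht : triples 0 = ∅ := by
      ext y
      simp only [mem_triples, Finset.notMem_empty, iff_false]
      omega
    simp [diffFun, ht]
  right' x s a l := by
    simp only [diffFun, List.length_append, List.length_cons, List.length_nil, Finset.smul_sum]
    refine Finset.sum_congr rfl fun ⟨r, n, t⟩ hy => ?_
    simp only [mem_triples] at hy ⊢
    rw [← op_smul_units]
    congr 1
    obtain ⟨i, rfl, h⟩ | h : (∃ i, n = i + 1 ∧ r + i = l.length) ∨ r + n ≤ l.length := by
      by_cases h : r + n ≤ l.length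
      · exact Or.inr h
      · exact Or.inl ⟨n - 1, by omega, by omega⟩
    · obtain ⟨p, q, rfl, rfl⟩ : ∃ p q, l = p ++ q ∧ r = p.length :=
        ⟨l.take r, l.drop r, by simp, by simp; omega⟩
      obtain rfl : i = q.length := by simpa using h
      simp [List.take_length_add_append, List.drop_length_add_append, A.mul_right, f.right']
    · obtain ⟨p, q, u, rfl, rfl, rfl⟩ : ∃ p q u, l = p ++ (q ++ u) ∧ r = p.length ∧
          n = q.length :=
        ⟨l.take r, (l.drop r).take n, (l.drop r).drop n, by simp, by simp; omega,
          by simp; omega⟩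
      have := f.right' (M.koszul (2 - q.length) x) s a
        (p.map (A.toGrMod.koszul (2 - q.length)) ++ A.mul q :: u)
      simpa [List.take_length_add_append, List.drop_length_add_append] using this

theorem diff_homog {d : ℤ} {f : Fam A.toGrBimod M N} (hf : f.IsHomog d) :
    (f.diff d).IsHomog (d + 1) := by
  intro x j l js hx hl
  change diffFun A d f x l ∈ _
  refine Submodule.sum_mem (N.deg _) fun ⟨r, n, t⟩ hy => ?_
  rw [mem_triples] at hy
  simp only at hy ⊢
  rw [Units.smul_def]
  refine zsmul_mem ?_ _
  have hq := (hl.drop r).take n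
  have hm := A.mul_deg _ _ (fun h => by
    have := congrArg List.length h
    simp only [List.length_take, List.length_drop, List.length_nil] at this
    omega) hq
  have h := hf _ _ _ _ (M.koszul_mem (2 - n) hx)
    (List.rel_append ((hl.take r).map_koszul (2 - n)) (List.Forall₂.cons hm (hl.drop (r + n))))
  convert h using 2
  have hs : js.sum = (js.take r).sum + (((js.drop r).take n).sum + (js.drop (r + n)).sum) := by
    rw [← List.drop_drop, ← List.sum_append, List.take_append_drop, ← List.sum_append,
      List.take_append_drop]
  have e₁ : min r l.length = r := by omega
  have e₂ : min n (l.length - r) = n := by omega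
  simp only [List.sum_append, List.sum_cons, List.length_append, List.length_cons,
    List.length_map, List.length_take, List.length_drop, e₁, e₂, hs]
  have e₃ : l.length - (r + n) = t := by omega
  rw [e₃, ← hy.1]
  push_cast
  ring

end

end Fam
end AInf

/-! ### The square of the differential -/

namespace AInf

variable {k : Type u₁} {S : Type u₂} [Field k] [Ring S] [Algebra k S]
  {A : AInfAlgebra.{u₁, u₂, v} k S} {M N L : GrMod.{u₂, w} S}

theorem take_drop_of_eq_append {α : Type*} {l p q w : List α} {r s : ℕ}
    (h : l = p ++ (q ++ w)) (hr : r = p.length) (hs : s = q.length) :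
    l.take r = p ∧ (l.drop r).take s = q ∧ l.drop (r + s) = w := by
  subst h hr hs
  simp [List.drop_length_add_append]

/-- The `A_∞`-relation inserted in one argument of a family. -/
theorem Fam.map_stasheff (f : Fam A.toGrBimod M N) (x : M) (p q w : List A.carrier) :
    ∑ z ∈ triples q.length, ((z.1 : ℤ) + z.2.1 * z.2.2).negOnePow •
      f x (p ++ A.mul ((q.take z.1).map (A.toGrMod.koszul (2 - z.2.1)) ++
          A.mul ((q.drop z.1).take z.2.1) :: q.drop (z.1 + z.2.1)) :: w) = 0 := by
  have h := congrArg (fun a => f x (p ++ a :: w)) (A.stasheff q)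
  simpa only [f.map_sum_at, f.map_units_smul_at, f.map_zero_at] using h

/-- The differential of families squares to zero. -/
theorem diffFun_diffFun (d : ℤ) (f : Fam A.toGrBimod M N) :
    diffFun A (d + 1) (diffFun A d f) = 0 := by
  funext x l
  simp only [diffFun, Pi.zero_apply, List.length_append, List.length_map,
    List.length_cons, List.length_take, List.length_drop,
    Finset.smul_sum, smul_smul, ← Int.negOnePow_add]
  -- A term consists of a block multiplied in `l`, followed by a block multiplied in the resulting
  -- list. The second block contains the value of the first, lies to its left, or lies to its right.
  rw [Finset.sum_sigma',
    ← Finset.sum_filter_add_sum_filter_not _ (fun y => y.2.1 ≤ y.1.1),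
    ← Finset.sum_filter_add_sum_filter_not (Finset.filter _ _) (fun y => y.1.1 < y.2.1 + y.2.2.1)]
  rw [add_assoc]
  refine (congrArg₂ (· + ·) ?_ ?_).trans (add_zero 0)
  swap
  -- Disjoint blocks: the same two operations in either order cancel. A second block at position
  -- `r'` to the right of the first one sits at position `r' - 1 + s` in `l`.
  · rw [add_comm, ← eq_neg_iff_add_eq_zero, ← Finset.sum_neg_distrib]
    refine Finset.sum_nbij'
      (fun y => ⟨(y.2.1 - 1 + y.1.2.1, y.2.2.1, y.2.2.2),
        (y.1.1, y.1.2.1, l.length - y.1.1 - y.1.2.1 - y.2.2.1 + 1)⟩)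
      (fun y => ⟨(y.2.1, y.2.2.1, l.length - y.2.1 - y.2.2.1), (y.1.1 + 1 - y.2.2.1, y.1.2.1, y.1.2.2)⟩)
      ?_ ?_ ?_ ?_ ?_
    · rintro ⟨⟨r, s, t⟩, ⟨r', s', t'⟩⟩ hy
      simp only [Finset.mem_filter, Finset.mem_sigma, mem_triples] at hy ⊢
      omega
    · rintro ⟨⟨r, s, t⟩, ⟨r', s', t'⟩⟩ hy
      simp only [Finset.mem_filter, Finset.mem_sigma, mem_triples] at hy ⊢
      omega
    · rintro ⟨⟨r, s, t⟩, ⟨r', s', t'⟩⟩ hy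
      simp only [Finset.mem_filter, Finset.mem_sigma, mem_triples] at hy
      simp only [Sigma.mk.injEq, Prod.mk.injEq, heq_eq_eq, true_and, and_true]
      omega
    · rintro ⟨⟨r, s, t⟩, ⟨r', s', t'⟩⟩ hy
      simp only [Finset.mem_filter, Finset.mem_sigma, mem_triples] at hy
      simp only [Sigma.mk.injEq, Prod.mk.injEq, heq_eq_eq, true_and, and_true]
      omega
    · rintro ⟨⟨r, s, t⟩, ⟨r', s', t'⟩⟩ hy
      simp only [Finset.mem_filter, Finset.mem_sigma, mem_triples] at hy
      obtain ⟨i, rfl⟩ : ∃ i, r' = r + (i + 1) := ⟨r' - r - 1, by omega⟩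
      obtain ⟨p, q, u, c, b, hl, hr, hs, hi, hs', ht'⟩ : ∃ p q u c b,
          l = p ++ (q ++ (u ++ (c ++ b))) ∧ r = p.length ∧ s = q.length ∧ i = u.length ∧
            s' = c.length ∧ t' = b.length :=
        ⟨l.take r, (l.drop r).take s, ((l.drop r).drop s).take i,
          (((l.drop r).drop s).drop i).take s', (((l.drop r).drop s).drop i).drop s',
          by simp, by simp; omega, by simp; omega, by simp; omega, by simp; omega, by simp; omega⟩
      have e₁ : r + (i + 1) - 1 + s = r + s + i := by omega
      have e₂ : l.length - r - s - s' + 1 = i + t' + 1 := by omega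
      have e₃ : t = i + s' + t' := by omega
      simp only [e₁, e₂, e₃]
      obtain ⟨a₁, a₂, a₃⟩ := take_drop_of_eq_append hl hr hs
      rw [a₁, a₂, a₃]
      obtain ⟨b₁, b₂, b₃⟩ := take_drop_of_eq_append (r := r + (i + 1)) (s := s')
        (p := p.map (A.toGrMod.koszul (2 - s)) ++ A.mul q :: u) (q := c) (w := b)
        (l := p.map (A.toGrMod.koszul (2 - s)) ++ A.mul q :: (u ++ (c ++ b)))
        (by simp) (by simp; omega) hs'
      rw [b₁, b₂, b₃]
      obtain ⟨c₁, c₂, c₃⟩ := take_drop_of_eq_append (r := r + s + i) (s := s')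
        (p := p ++ (q ++ u)) (q := c) (w := b) (l := l)
        (by simp [hl]) (by simp; omega) hs'
      rw [c₁, c₂, c₃]
      obtain ⟨d₁, d₂, d₃⟩ := take_drop_of_eq_append (r := r) (s := s)
        (p := p.map (A.toGrMod.koszul (2 - s'))) (q := q.map (A.toGrMod.koszul (2 - s')))
        (w := u.map (A.toGrMod.koszul (2 - s')) ++ A.mul c :: b)
        (l := (p ++ (q ++ u)).map (A.toGrMod.koszul (2 - s')) ++ A.mul c :: b)
        (by simp) (by simp; omega) (by simp; omega)
      rw [d₁, d₂, d₃]
      -- The Koszul operator of `m_{s'}` passes through the value of `m_s`, which contributes the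
      -- sign with exponent `(2 - s') (2 - s)`.
      simp only [List.map_append, List.map_cons, List.map_map, List.append_assoc,
        List.cons_append, GrMod.koszul_koszul, Function.comp_def, A.koszul_mul,
        f.map_units_smul_at, smul_smul, ← Int.negOnePow_add, add_comm (2 - (s : ℤ)) (2 - (s' : ℤ))]
      rw [← Units.neg_smul, ← Int.negOnePow_succ, ← hs]
      congr 1
      rw [Int.negOnePow_eq_iff]
      push_cast
      exact ⟨2 - 2 * s + s * s' - s', by ring⟩
  -- Nested blocks: the terms are regrouped by the union of the two blocks in `l`. Blocks of lengths
  -- `s` and `s'` have a union of length `s + s' - 1`, and `(2 - s) + (2 - s') = 3 - (s + s' - 1)`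
  -- explains the 3. For a fixed union, the sum is an `A_∞`-relation.
  · trans ∑ y ∈ (triples l.length).sigma (fun y => triples y.2.1),
      (1 + (y.1.2.1 + 1) * y.1.2.2 : ℤ).negOnePow • ((y.2.1 : ℤ) + y.2.2.1 * y.2.2.2).negOnePow •
        f (M.koszul (3 - y.1.2.1) x) ((l.take y.1.1).map (A.toGrMod.koszul (3 - y.1.2.1)) ++
          A.mul ((((l.drop y.1.1).take y.1.2.1).take y.2.1).map (A.toGrMod.koszul (2 - y.2.2.1)) ++
          A.mul ((((l.drop y.1.1).take y.1.2.1).drop y.2.1).take y.2.2.1) ::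
          ((l.drop y.1.1).take y.1.2.1).drop (y.2.1 + y.2.2.1)) :: l.drop (y.1.1 + y.1.2.1))
    · refine Finset.sum_nbij'
        (fun y => ⟨(y.2.1, y.2.2.1 + y.1.2.1 - 1, y.2.2.2),
          (y.1.1 - y.2.1, y.1.2.1, y.1.2.2 - y.2.2.2)⟩)
        (fun y => ⟨(y.1.1 + y.2.1, y.2.2.1, y.2.2.2 + y.1.2.2),
          (y.1.1, y.2.1 + 1 + y.2.2.2, y.1.2.2)⟩) ?_ ?_ ?_ ?_ ?_
      · rintro ⟨⟨r, s, t⟩, ⟨r', s', t'⟩⟩ hy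
        simp only [Finset.mem_filter, Finset.mem_sigma, mem_triples] at hy ⊢
        omega
      · rintro ⟨⟨r, s, t⟩, ⟨r', s', t'⟩⟩ hy
        simp only [Finset.mem_filter, Finset.mem_sigma, mem_triples] at hy ⊢
        omega
      · rintro ⟨⟨r, s, t⟩, ⟨r', s', t'⟩⟩ hy
        simp only [Finset.mem_filter, Finset.mem_sigma, mem_triples] at hy
        simp only [Sigma.mk.injEq, Prod.mk.injEq, heq_eq_eq, true_and, and_true]
        omega
      · rintro ⟨⟨r, s, t⟩, ⟨r', s', t'⟩⟩ hy
        simp only [Finset.mem_sigma, mem_triples] at hy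
        simp only [Sigma.mk.injEq, Prod.mk.injEq, heq_eq_eq, true_and, and_true]
        omega
      · rintro ⟨⟨r, s, t⟩, ⟨r', s', t'⟩⟩ hy
        simp only [Finset.mem_filter, Finset.mem_sigma, mem_triples] at hy
        obtain ⟨i, rfl⟩ : ∃ i, r = r' + i := ⟨r - r', by omega⟩
        obtain ⟨j, rfl⟩ : ∃ j, s' = i + 1 + j := ⟨s' - 1 - i, by omega⟩
        obtain ⟨p, a, q, b, c, hl, hr, hi, hs, hj, ht⟩ : ∃ p a q b c,
            l = p ++ (a ++ (q ++ (b ++ c))) ∧ r' = p.length ∧ i = a.length ∧ s = q.length ∧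
              j = b.length ∧ t' = c.length :=
          ⟨l.take r', (l.drop r').take i, ((l.drop r').drop i).take s,
            (((l.drop r').drop i).drop s).take j, (((l.drop r').drop i).drop s).drop j,
            by simp, by simp; omega, by simp; omega, by simp; omega, by simp; omega,
            by simp; omega⟩
        have e₁ : i + 1 + j + s - 1 = i + s + j := by omega
        have e₂ : r' + i - r' = i := by omega
        have e₃ : t = j + t' := by omega
        have e₄ : j + t' - t' = j := by omega
        simp only [e₁, e₂, e₃, e₄]
        obtain ⟨a₁, a₂, a₃⟩ := take_drop_of_eq_append (l := l) (r := r' + i) (s := s)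
          (p := p ++ a) (q := q) (w := b ++ c) (by simp [hl]) (by simp; omega) hs
        rw [a₁, a₂, a₃]
        obtain ⟨b₁, b₂, b₃⟩ := take_drop_of_eq_append (r := r') (s := i + 1 + j)
          (p := p.map (A.toGrMod.koszul (2 - s)))
          (q := a.map (A.toGrMod.koszul (2 - s)) ++ A.mul q :: b) (w := c)
          (l := (p ++ a).map (A.toGrMod.koszul (2 - s)) ++ A.mul q :: (b ++ c))
          (by simp) (by simp; omega) (by simp; omega)
        rw [b₁, b₂, b₃]
        obtain ⟨c₁, c₂, c₃⟩ := take_drop_of_eq_append (l := l) (r := r') (s := i + s + j)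
          (p := p) (q := a ++ (q ++ b)) (w := c) (by simp [hl]) hr (by simp; omega)
        rw [c₁, c₂, c₃]
        obtain ⟨d₁, d₂, d₃⟩ := take_drop_of_eq_append (l := a ++ (q ++ b)) rfl hi hs
        rw [d₁, d₂, d₃]
        have e : (2 : ℤ) - (i + 1 + j : ℕ) + (2 - s) = 3 - (i + s + j : ℕ) := by
          push_cast; ring
        simp only [List.map_map, GrMod.koszul_koszul, Function.comp_def, smul_smul,
          ← Int.negOnePow_add, e]
        congr 1
        rw [Int.negOnePow_eq_iff]
        push_cast
        exact ⟨2 + d + r', by ring⟩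
    · rw [Finset.sum_sigma]
      refine Finset.sum_eq_zero fun ⟨r, s, t⟩ hy => ?_
      rw [mem_triples] at hy
      simp only [← Finset.smul_sum] at hy ⊢
      have h := f.map_stasheff (M.koszul (3 - s) x) ((l.take r).map (A.toGrMod.koszul (3 - s)))
        ((l.drop r).take s) (l.drop (r + s))
      have e : ((l.drop r).take s).length = s := by
        simp only [List.length_take, List.length_drop]; omega
      rw [e] at h
      rw [h, smul_zero]
end AInf

/-! ### The complex of families between two modules -/

namespace AInf

variable {k : Type u₁} {S : Type u₂} [Field k] [Ring S] [Algebra k S]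

namespace Fam

section

variable {A : GrBimod.{u₁, u₂, v} k S} {M N L : GrMod.{u₂, w} S}

/-- The sum of two families. -/
def add (f g : Fam A M N) : Fam A M N where
  toFun := f.toFun + g.toFun
  add_left' x y l := by simp only [Pi.add_apply, f.add_left', g.add_left']; abel
  map_add' x l₁ l₂ a b := by simp only [Pi.add_apply, f.map_add', g.map_add']; abel
  balanced_left' x s a l := by simp only [Pi.add_apply, f.balanced_left', g.balanced_left']
  balanced' x l₁ l₂ a b s := by simp only [Pi.add_apply, f.balanced', g.balanced']
  right_nil' x s := by simp only [Pi.add_apply, f.right_nil', g.right_nil', smul_add]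
  right' x s a l := by simp only [Pi.add_apply, f.right', g.right', smul_add]

/-- A family multiplied by a sign. -/
def unitsSMul (c : ℤˣ) (f : Fam A M N) : Fam A M N where
  toFun := c • f.toFun
  add_left' x y l := by simp only [Pi.smul_apply, f.add_left', smul_add]
  map_add' x l₁ l₂ a b := by simp only [Pi.smul_apply, f.map_add', smul_add]
  balanced_left' x s a l := by simp only [Pi.smul_apply, f.balanced_left']
  balanced' x l₁ l₂ a b s := by simp only [Pi.smul_apply, f.balanced']
  right_nil' x s := by simp only [Pi.smul_apply, f.right_nil', op_smul_units]
  right' x s a l := by simp only [Pi.smul_apply, f.right', op_smul_units]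

theorem add_homog {d : ℤ} {f g : Fam A M N} (hf : f.IsHomog d) (hg : g.IsHomog d) :
    (f.add g).IsHomog d :=
  fun x j l js hx hl => Submodule.add_mem (N.deg _) (hf x j l js hx hl) (hg x j l js hx hl)

theorem unitsSMul_homog {d : ℤ} (c : ℤˣ) {f : Fam A M N} (hf : f.IsHomog d) :
    (f.unitsSMul c).IsHomog d := by
  intro x j l js hx hl
  change c • f x l ∈ _
  rw [Units.smul_def]
  exact zsmul_mem (hf x j l js hx hl) _

theorem compFun_smul_left {d : ℤ} (c : ℤˣ) (g : N → List A → L) (f : M → List A → N) :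
    compFun d (c • g) f = c • compFun d g f := by
  funext x l
  simp only [compFun, Pi.smul_apply, Finset.smul_sum]
  exact Finset.sum_congr rfl fun _ _ => smul_comm _ _ _

theorem compFun_smul_right {d : ℤ} (c : ℤˣ) (g : Fam A N L) (f : M → List A → N) :
    compFun d g (c • f) = c • compFun d g f := by
  funext x l
  simp only [compFun, Pi.smul_apply, Finset.smul_sum, g.map_units_smul]
  exact Finset.sum_congr rfl fun _ _ => smul_comm _ _ _

end

end Fam

section

variable {A : AInfAlgebra.{u₁, u₂, v} k S} {M : GrMod.{u₂, w} S} {N : Type w} [AddCommGroup N]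

theorem diffFun_add {d : ℤ} (f g : M → List A.carrier → N) :
    diffFun A d (f + g) = diffFun A d f + diffFun A d g := by
  funext x l
  simp only [diffFun, Pi.add_apply, smul_add, Finset.sum_add_distrib]

theorem diffFun_smul {d : ℤ} (c : ℤˣ) (f : M → List A.carrier → N) :
    diffFun A d (c • f) = c • diffFun A d f := by
  funext x l
  simp only [diffFun, Pi.smul_apply, Finset.smul_sum]
  exact Finset.sum_congr rfl fun _ _ => smul_comm _ _ _

end

namespace AInfModule

variable {A : AInfAlgebra.{u₁, u₂, v} k S} {M N L : AInfModule.{u₁, u₂, v, w} A}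

/-- The differential of the complex of families between two modules. -/
noncomputable def homDiff (d : ℤ) (f : Fam A.toGrBimod M.toGrMod N.toGrMod) :
    Fam A.toGrBimod M.toGrMod N.toGrMod :=
  ((f.diff d).add (Fam.comp d N.act f)).sub ((Fam.comp 1 f M.act).unitsSMul d.negOnePow)

theorem homDiff_toFun (d : ℤ) (f : Fam A.toGrBimod M.toGrMod N.toGrMod) :
    (homDiff d f).toFun =
      diffFun A d f + compFun d N.act f - d.negOnePow • compFun 1 f M.act := rfl

theorem homDiff_homog {d : ℤ} {f : Fam A.toGrBimod M.toGrMod N.toGrMod} (hf : f.IsHomog d) :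
    (homDiff d f).IsHomog (d + 1) :=
  Fam.sub_homog (Fam.add_homog (Fam.diff_homog hf) (Fam.comp_homog N.act_homog hf))
    (Fam.unitsSMul_homog _ (add_comm 1 d ▸ Fam.comp_homog hf M.act_homog))

theorem homDiff_add (d : ℤ) (f g : Fam A.toGrBimod M.toGrMod N.toGrMod) :
    (homDiff d (f.add g)).toFun = (homDiff d f).toFun + (homDiff d g).toFun := by
  simp only [homDiff_toFun]
  change diffFun A d (f.toFun + g.toFun) + compFun d N.act (f.toFun + g.toFun) -
    d.negOnePow • compFun 1 (f.toFun + g.toFun) M.act = _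
  rw [diffFun_add, Fam.compFun_add_right, Fam.compFun_add_left, smul_add]
  abel

theorem homDiff_sub (d : ℤ) (f g : Fam A.toGrBimod M.toGrMod N.toGrMod) :
    (homDiff d (f.sub g)).toFun = (homDiff d f).toFun - (homDiff d g).toFun := by
  simp only [homDiff_toFun]
  change diffFun A d (f.toFun - g.toFun) + compFun d N.act (f.toFun - g.toFun) -
    d.negOnePow • compFun 1 (f.toFun - g.toFun) M.act = _
  rw [diffFun_sub, Fam.compFun_sub_right, Fam.compFun_sub_left, smul_sub]
  abel

/-- By the Leibniz rule and associativity, the mixed terms cancel in pairs. What remains contains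
`δ(m) + m ∘ m` for the two actions, which is zero by the module relations, and the square of
`diffFun`. -/
theorem homDiff_homDiff {d : ℤ} {f : Fam A.toGrBimod M.toGrMod N.toGrMod} (hf : f.IsHomog d) :
    (homDiff (d + 1) (homDiff d f)).toFun = 0 := by
  simp only [homDiff_toFun, diffFun_add, diffFun_sub, diffFun_smul, Fam.compFun_add_left,
    Fam.compFun_sub_left, Fam.compFun_add_right, Fam.compFun_sub_right, Fam.compFun_smul_left,
    Fam.compFun_smul_right, diffFun_diffFun]
  have h₁ := diffFun_comp (d := d) (e := 1) N.act hf
  have h₂ := diffFun_comp (d := 1) (e := d) f M.act_homog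
  have a₁ := Fam.compFun_assoc (d := d) (e := 1) N.act N.act.toFun f.toFun
  have a₂ := Fam.compFun_assoc (d := 1) (e := d) N.act f.toFun M.act.toFun
  have a₃ := Fam.compFun_assoc (d := 1) (e := 1) f M.act.toFun M.act.toFun
  rw [add_comm 1 d] at h₂ a₂
  have hN := eq_neg_of_add_eq_zero_left N.act_rel
  have hM := eq_neg_of_add_eq_zero_left M.act_rel
  rw [hN] at h₁
  rw [hM] at h₂
  have n₁ : compFun d (-compFun 1 N.act.toFun N.act.toFun) f.toFun =
      -compFun d (compFun 1 N.act.toFun N.act.toFun) f.toFun := by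
    rw [← zero_sub, Fam.compFun_sub_left, sub_eq_neg_self]
    funext x l
    simp [compFun]
  have n₂ : compFun (1 + 1) f (-compFun 1 M.act.toFun M.act.toFun) =
      -compFun (1 + 1) f (compFun 1 M.act.toFun M.act.toFun) := by
    rw [← zero_sub, Fam.compFun_sub_right, sub_eq_neg_self]
    funext x l
    simp [compFun, f.map_zero]
  rw [h₁, h₂, n₁, n₂, ← a₁, a₂, a₃]
  simp only [Int.negOnePow_succ, Int.negOnePow_one, Units.neg_smul, one_smul, smul_add, smul_sub,
    smul_neg]
  abel

/-- Composition with `f` is a chain map because `f` is closed: the Leibniz term containing the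
differential of `f` is absorbed by `Hom.diff_eq`. -/
theorem homDiff_comp {d : ℤ} (f : Hom M N) {a : Fam A.toGrBimod L.toGrMod M.toGrMod}
    (ha : a.IsHomog d) :
    (homDiff d (Fam.comp d f.fam a)).toFun = compFun (d + 1) f.fam (homDiff d a) := by
  simp only [homDiff_toFun, Fam.compFun_add_right, Fam.compFun_sub_right, Fam.compFun_smul_right]
  change diffFun A d (compFun d f.fam a) + compFun d N.act (compFun d f.fam a) -
    d.negOnePow • compFun 1 (compFun d f.fam a) L.act = _
  have h := diffFun_comp (d := d) (e := 0) f.fam ha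
  have a₁ := Fam.compFun_assoc (d := d) (e := 0) N.act f.fam.toFun a.toFun
  have a₂ := Fam.compFun_assoc (d := d) (e := 1) f.fam M.act.toFun a.toFun
  have a₃ := Fam.compFun_assoc (d := 1) (e := d) f.fam a.toFun L.act.toFun
  rw [add_comm 1 d] at a₃
  simp only [add_zero, Int.negOnePow_zero, one_smul] at h a₁
  rw [h, f.diff_eq, Fam.compFun_sub_left, a₁, a₂, a₃]
  abel

end AInfModule
end AInf

/-! ### Families vanishing on short lists -/

namespace AInf

variable {k : Type u₁} {S : Type u₂} [Field k] [Ring S] [Algebra k S]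

namespace Fam

variable {A : GrBimod.{u₁, u₂, v} k S} {M N L : GrMod.{u₂, w} S}

/-- Composition of a family with a linear map. -/
def postcomp (φ : M →ₗ[Sᵐᵒᵖ] N) (a : Fam A L M) : Fam A L N where
  toFun x l := φ (a x l)
  add_left' x y l := by simp only [a.add_left', map_add]
  map_add' x l₁ l₂ b c := by simp only [a.map_add', map_add]
  balanced_left' x s b l := by simp only [a.balanced_left']
  balanced' x l₁ l₂ b c s := by simp only [a.balanced']
  right_nil' x s := by simp only [a.right_nil', map_smul]
  right' x s b l := by simp only [a.right', map_smul]

theorem postcomp_homog {d e d' : ℤ} (h : d + e = d') {φ : M →ₗ[Sᵐᵒᵖ] N}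
    (hφ : ∀ i, ∀ x ∈ M.deg i, φ x ∈ N.deg (i + e)) {a : Fam A L M} (ha : a.IsHomog d) :
    (postcomp φ a).IsHomog d' := by
  intro x j l js hx hl
  have := hφ _ _ (ha x j l js hx hl)
  change φ (a x l) ∈ _
  convert this using 2
  rw [← h]
  ring

/-- The family whose values on lists of length `n` are those of `F n`. -/
def diagonal (F : ℕ → Fam A M N) : Fam A M N where
  toFun x l := F l.length x l
  add_left' x y l := (F _).add_left' x y l
  map_add' x l₁ l₂ a b := by
    simpa only [List.length_append, List.length_cons] using (F _).map_add' x l₁ l₂ a b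
  balanced_left' x s a l := (F _).balanced_left' x s a l
  balanced' x l₁ l₂ a b s := by
    simpa only [List.length_append, List.length_cons] using (F _).balanced' x l₁ l₂ a b s
  right_nil' x s := (F _).right_nil' x s
  right' x s a l := by
    simpa only [List.length_append, List.length_cons] using (F _).right' x s a l

theorem diagonal_homog {d : ℤ} {F : ℕ → Fam A M N} (hF : ∀ n, (F n).IsHomog d) :
    (diagonal F).IsHomog d :=
  fun x j l js hx hl => hF l.length x j l js hx hl

theorem compFun_congr_right {d : ℤ} (g : N → List A → L) {f f' : M → List A → N} {l : List A}
    (h : ∀ x (l' : List A), l'.length ≤ l.length → f x l' = f' x l') (x : M) :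
    compFun d g f x l = compFun d g f' x l :=
  Finset.sum_congr rfl fun p _ => by rw [h x _ (List.length_take_le' _ _)]

theorem compFun_congr_left {d : ℤ} {g g' : N → List A → L} (f : M → List A → N) {l : List A}
    (h : ∀ x (l' : List A), l'.length ≤ l.length → g x l' = g' x l') (x : M) :
    compFun d g f x l = compFun d g' f x l :=
  Finset.sum_congr rfl fun p _ => by rw [h _ (l.drop p.1) (by simp)]

/-- Any term that leaves an argument to the outer family evaluates the inner one on a list shorter
than `p`. Only the linear part of the outer family survives, which reduces the problem at each
length to one about complexes. -/
theorem compFun_of_vanish {d : ℤ} {p : ℕ} (g : Fam A N L) {f : M → List A → N}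
    (h : ∀ x (l : List A), l.length < p → f x l = 0) (x : M) {l : List A} (hl : l.length ≤ p) :
    compFun d g f x l = g.first (f x l) := by
  rw [compFun, Finset.sum_eq_single (l.length, 0)]
  · simp only [List.take_length, List.drop_length, Nat.cast_zero, mul_zero, Int.negOnePow_zero,
      one_smul]
    rfl
  · rintro ⟨i, j⟩ hij hne
    rw [Finset.HasAntidiagonal.mem_antidiagonal] at hij
    have hj : j ≠ 0 := by
      rintro rfl
      exact hne (by simp [← hij])
    simp only at hij
    rw [h x _ (by simp only [List.length_take]; omega), g.map_zero, smul_zero]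
  · simp

end Fam

/-- Since there is no `m_0`, inserting an operation never lengthens a list. The differential is
therefore determined length by length, which makes the passage to a limit possible. -/
theorem diffFun_congr {A : AInfAlgebra.{u₁, u₂, v} k S} {M : GrMod.{u₂, w} S} {N : Type w}
    [AddCommGroup N] {d : ℤ} {f f' : M → List A.carrier → N} {l : List A.carrier}
    (h : ∀ x (l' : List A.carrier), l'.length ≤ l.length → f x l' = f' x l') (x : M) :
    diffFun A d f x l = diffFun A d f' x l := by
  refine Finset.sum_congr rfl fun y hy => ?_
  rw [mem_triples] at hy
  rw [h]
  simp only [List.length_append, List.length_map, List.length_take, List.length_cons,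
    List.length_drop]
  omega

namespace AInfModule

variable {A : AInfAlgebra.{u₁, u₂, v} k S} {M N L : AInfModule.{u₁, u₂, v, w} A}

theorem homDiff_congr {d : ℤ} {f f' : Fam A.toGrBimod M.toGrMod N.toGrMod} {l : List A.carrier}
    (h : ∀ x (l' : List A.carrier), l'.length ≤ l.length → f x l' = f' x l') (x : M.toGrMod) :
    homDiff d f x l = homDiff d f' x l := by
  simp only [homDiff_toFun, Pi.add_apply, Pi.sub_apply, Pi.smul_apply]
  rw [diffFun_congr h, Fam.compFun_congr_right _ h, Fam.compFun_congr_left _ h]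

theorem homDiff_unitsSMul (d : ℤ) (c : ℤˣ) (f : Fam A.toGrBimod M.toGrMod N.toGrMod) :
    (homDiff d (f.unitsSMul c)).toFun = c • (homDiff d f).toFun := by
  simp only [homDiff_toFun]
  change diffFun A d (c • f.toFun) + compFun d N.act (c • f.toFun) -
    d.negOnePow • compFun 1 (c • f.toFun) M.act = _
  rw [diffFun_smul, Fam.compFun_smul_right, Fam.compFun_smul_left, smul_sub, smul_add,
    smul_comm c d.negOnePow]

theorem homDiff_one : (homDiff 0 (Fam.one A.toGrBimod M.toGrMod) :
    Fam A.toGrBimod M.toGrMod M.toGrMod).toFun = 0 := by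
  rw [homDiff_toFun, Fam.diffFun_one, Fam.compFun_one_left, Fam.compFun_one_right]
  simp

/-- Applying `φ` commutes with precomposition by the action of `L`, and up to the sign of `e` with
the insertion of operations of `A`. The actions of `M` and `N` enter only through `m_1` at these
lengths, so the error is the graded commutator of `φ` with `m_1`. -/
theorem homDiff_postcomp {d e d' : ℤ} (hd : d + e = d') {p : ℕ}
    (φ : M.toGrMod →ₗ[Sᵐᵒᵖ] N.toGrMod)
    {a : Fam A.toGrBimod L.toGrMod M.toGrMod}
    (ha : ∀ x (l : List A.carrier), l.length < p → a x l = 0) (x : L.toGrMod)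
    {l : List A.carrier} (hl : l.length ≤ p) :
    homDiff d' (Fam.postcomp φ a) x l = N.act.first (φ (a x l)) -
      e.negOnePow • φ (M.act.first (a x l)) + e.negOnePow • φ (homDiff d a x l) := by
  have h₁ : diffFun A d' (Fam.postcomp φ a) x l = e.negOnePow • φ (diffFun A d a x l) := by
    simp only [diffFun, map_sum, Finset.smul_sum, ← hd]
    refine Finset.sum_congr rfl fun y _ => ?_
    rw [Units.smul_def (Int.negOnePow _) (a.toFun _ _), map_zsmul, ← Units.smul_def, smul_smul,
      ← Int.negOnePow_add]
    congr 2
    ring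
  have h₂ : compFun 1 (Fam.postcomp φ a) L.act x l = φ (compFun 1 a L.act x l) := by
    simp only [compFun, map_sum]
    refine Finset.sum_congr rfl fun y _ => ?_
    rw [Units.smul_def (Int.negOnePow _) (a.toFun _ _), map_zsmul, ← Units.smul_def]
    rfl
  have h₃ : compFun d' N.act (Fam.postcomp φ a) x l = N.act.first (φ (a x l)) :=
    Fam.compFun_of_vanish N.act
      (fun x l h => by change φ (a x l) = 0; rw [ha x l h, map_zero]) x hl
  have h₄ : compFun d M.act a x l = M.act.first (a x l) := Fam.compFun_of_vanish M.act ha x hl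
  simp only [homDiff_toFun, Pi.add_apply, Pi.sub_apply, Pi.smul_apply, map_add, map_sub]
  rw [h₁, h₂, h₃, h₄, ← hd, Int.negOnePow_add, Units.smul_def d.negOnePow (compFun _ _ _ _ _),
    map_zsmul, ← Units.smul_def, mul_comm, ← smul_smul, smul_sub, smul_add]
  abel

/-- A contraction of the cone of the first component of a morphism `f`, that is, linear maps
`(m, n) ↦ (K m + G n, E m + H n)` with `∂ s + s ∂ = id` for `∂ (m, n) = (d m, f m - d n)`. -/
structure ConeContraction (f : Hom M N) where
  K : M.toGrMod →ₗ[Sᵐᵒᵖ] M.toGrMod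
  G : N.toGrMod →ₗ[Sᵐᵒᵖ] M.toGrMod
  E : M.toGrMod →ₗ[Sᵐᵒᵖ] N.toGrMod
  H : N.toGrMod →ₗ[Sᵐᵒᵖ] N.toGrMod
  K_mem : ∀ i, ∀ x ∈ M.deg i, K x ∈ M.deg (i + -1)
  G_mem : ∀ i, ∀ x ∈ N.deg i, G x ∈ M.deg (i + 0)
  E_mem : ∀ i, ∀ x ∈ M.deg i, E x ∈ N.deg (i + -2)
  H_mem : ∀ i, ∀ x ∈ N.deg i, H x ∈ N.deg (i + -1)
  comm_G : ∀ y, M.act.first (G y) = G (N.act.first y)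
  homotopy_left : ∀ x, G (f.fam.first x) + M.act.first (K x) + K (M.act.first x) = x
  homotopy_right : ∀ y, f.fam.first (G y) - N.act.first (H y) - H (N.act.first y) = y
  coherence : ∀ x, f.fam.first (K x) + H (f.fam.first x) - N.act.first (E x) +
    E (M.act.first x) = 0

/-! ### Successive correction of an approximate inverse -/

section

variable (f : Hom M N) (c : ConeContraction f)

/-- The failure of `g` to be a morphism. -/
noncomputable def defect₁ (g : Fam A.toGrBimod N.toGrMod M.toGrMod) :
    Fam A.toGrBimod N.toGrMod M.toGrMod :=
  (homDiff 0 g).unitsSMul (-1)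

/-- The failure of `h` to be a homotopy from `f ∘ g` to the identity. -/
noncomputable def defect₂ (g : Fam A.toGrBimod N.toGrMod M.toGrMod)
    (h : Fam A.toGrBimod N.toGrMod N.toGrMod) : Fam A.toGrBimod N.toGrMod N.toGrMod :=
  ((Fam.one _ _).sub (Fam.comp 0 f.fam g)).add (homDiff (-1) h)

theorem defect₁_toFun (g : Fam A.toGrBimod N.toGrMod M.toGrMod) :
    (defect₁ g).toFun = -(homDiff 0 g).toFun := by
  change (-1 : ℤˣ) • (homDiff 0 g).toFun = _
  rw [Units.neg_smul, one_smul]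

theorem defect₂_toFun (g : Fam A.toGrBimod N.toGrMod M.toGrMod)
    (h : Fam A.toGrBimod N.toGrMod N.toGrMod) :
    (defect₂ f g h).toFun =
      (Fam.one _ _ : Fam A.toGrBimod N.toGrMod N.toGrMod).toFun - compFun 0 f.fam g +
        (homDiff (-1) h).toFun := rfl

theorem defect₁_homog {g : Fam A.toGrBimod N.toGrMod M.toGrMod} (hg : g.IsHomog 0) :
    (defect₁ g).IsHomog 1 :=
  Fam.unitsSMul_homog _ (homDiff_homog hg)

theorem defect₂_homog {g : Fam A.toGrBimod N.toGrMod M.toGrMod} (hg : g.IsHomog 0)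
    {h : Fam A.toGrBimod N.toGrMod N.toGrMod} (hh : h.IsHomog (-1)) :
    (defect₂ f g h).IsHomog 0 :=
  Fam.add_homog (Fam.sub_homog Fam.one_homog (Fam.comp_homog f.homog hg)) (homDiff_homog hh)

theorem homDiff_defect₁ {g : Fam A.toGrBimod N.toGrMod M.toGrMod} (hg : g.IsHomog 0) :
    (homDiff 1 (defect₁ g)).toFun = 0 := by
  rw [defect₁, homDiff_unitsSMul, ← zero_add (1 : ℤ), homDiff_homDiff hg, smul_zero]

/-- Together with `homDiff_defect₁`, this says that the pair of defects `(0, 1) - ∂(g, h)` is a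
cocycle in the cone of composition with `f`. It holds because the identity is closed and `homDiff`
squares to zero. -/
theorem homDiff_defect₂ {g : Fam A.toGrBimod N.toGrMod M.toGrMod} (hg : g.IsHomog 0)
    {h : Fam A.toGrBimod N.toGrMod N.toGrMod} (hh : h.IsHomog (-1)) :
    (homDiff 0 (defect₂ f g h)).toFun = compFun 1 f.fam (defect₁ g) := by
  have h₁ := homDiff_homDiff hh
  simp only [neg_add_cancel] at h₁
  rw [defect₂, homDiff_add, homDiff_sub, homDiff_one, h₁, homDiff_comp f hg, defect₁_toFun,
    ← zero_sub (homDiff 0 g).toFun, Fam.compFun_sub_right, add_zero]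
  congr 1
  funext x l
  simp [compFun, f.fam.map_zero]

/-- The first component of the improvement of an approximate inverse. -/
noncomputable def improve₁ (g : Fam A.toGrBimod N.toGrMod M.toGrMod)
    (h : Fam A.toGrBimod N.toGrMod N.toGrMod) : Fam A.toGrBimod N.toGrMod M.toGrMod :=
  g.add ((Fam.postcomp c.G (defect₂ f g h)).add (Fam.postcomp c.K (defect₁ g)))

/-- The second component of the improvement of an approximate inverse. -/
noncomputable def improve₂ (g : Fam A.toGrBimod N.toGrMod M.toGrMod)
    (h : Fam A.toGrBimod N.toGrMod N.toGrMod) : Fam A.toGrBimod N.toGrMod N.toGrMod :=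
  h.add ((Fam.postcomp c.H (defect₂ f g h)).add (Fam.postcomp c.E (defect₁ g)))

variable {f} {g : Fam A.toGrBimod N.toGrMod M.toGrMod} {h : Fam A.toGrBimod N.toGrMod N.toGrMod}

theorem improve₁_apply (x : N.toGrMod) (l : List A.carrier) :
    improve₁ f c g h x l = g x l + (c.G (defect₂ f g h x l) + c.K (defect₁ g x l)) := rfl

theorem improve₂_apply (x : N.toGrMod) (l : List A.carrier) :
    improve₂ f c g h x l = h x l + (c.H (defect₂ f g h x l) + c.E (defect₁ g x l)) := rfl

theorem improve₁_homog (hg : g.IsHomog 0) (hh : h.IsHomog (-1)) :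
    (improve₁ f c g h).IsHomog 0 :=
  Fam.add_homog hg (Fam.add_homog
    (Fam.postcomp_homog (by norm_num) c.G_mem (defect₂_homog f hg hh))
    (Fam.postcomp_homog (by norm_num) c.K_mem (defect₁_homog hg)))

theorem improve₂_homog (hg : g.IsHomog 0) (hh : h.IsHomog (-1)) :
    (improve₂ f c g h).IsHomog (-1) :=
  Fam.add_homog hh (Fam.add_homog
    (Fam.postcomp_homog (by norm_num) c.H_mem (defect₂_homog f hg hh))
    (Fam.postcomp_homog (by norm_num) c.E_mem (defect₁_homog hg)))

/-- The `M`-component of `D - ∂ s D = s ∂ D = 0`. Here `comm_G` removes the commutator of `G` with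
`m_1`, and `homotopy_left` identifies what is left with the old defect. -/
theorem defect₁_improve
    (hg : g.IsHomog 0) (hh : h.IsHomog (-1)) {p : ℕ}
    (h₁ : ∀ x (l : List A.carrier), l.length < p → defect₁ g x l = 0)
    (h₂ : ∀ x (l : List A.carrier), l.length < p → defect₂ f g h x l = 0)
    (x : N.toGrMod) {l : List A.carrier} (hl : l.length ≤ p) :
    defect₁ (improve₁ f c g h) x l = 0 := by
  have e₁ := homDiff_postcomp (L := N) (d := 0) (e := 0) (d' := 0) rfl c.G h₂ x hl
  have e₂ := homDiff_postcomp (L := N) (d := 1) (e := -1) (d' := 0) rfl c.K h₁ x hl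
  rw [homDiff_defect₂ f hg hh, Fam.compFun_of_vanish f.fam h₁ x hl] at e₁
  rw [homDiff_defect₁ hg] at e₂
  rw [defect₁_toFun, Pi.neg_apply, Pi.neg_apply, improve₁, homDiff_add, homDiff_add]
  simp only [Pi.add_apply]
  rw [e₁, e₂, c.comm_G]
  have e₃ := c.homotopy_left (defect₁ g x l)
  have e₄ : homDiff 0 g x l = -defect₁ g x l := by simp [defect₁_toFun]
  rw [e₄, neg_eq_zero]
  simp only [Int.negOnePow_zero, Int.negOnePow_neg, Int.negOnePow_one, Units.neg_smul, one_smul,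
    Pi.zero_apply, map_zero]
  refine Eq.trans ?_ (sub_eq_zero.mpr e₃)
  abel

/-- The `N`-component of the same computation, carried by `homotopy_right` and `coherence`. -/
theorem defect₂_improve
    (hg : g.IsHomog 0) (hh : h.IsHomog (-1)) {p : ℕ}
    (h₁ : ∀ x (l : List A.carrier), l.length < p → defect₁ g x l = 0)
    (h₂ : ∀ x (l : List A.carrier), l.length < p → defect₂ f g h x l = 0)
    (x : N.toGrMod) {l : List A.carrier} (hl : l.length ≤ p) :
    defect₂ f (improve₁ f c g h) (improve₂ f c g h) x l = 0 := by
  have e₁ := homDiff_postcomp (L := N) (d := 0) (e := -1) (d' := -1) rfl c.H h₂ x hl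
  have e₂ := homDiff_postcomp (L := N) (d := 1) (e := -2) (d' := -1) rfl c.E h₁ x hl
  rw [homDiff_defect₂ f hg hh, Fam.compFun_of_vanish f.fam h₁ x hl] at e₁
  rw [homDiff_defect₁ hg] at e₂
  have e₃ : compFun 0 f.fam ((Fam.postcomp c.G (defect₂ f g h)).add
      (Fam.postcomp c.K (defect₁ g))).toFun x l =
        f.fam.first (c.G (defect₂ f g h x l) + c.K (defect₁ g x l)) := by
    refine Fam.compFun_of_vanish f.fam (fun x l hl => ?_) x hl
    change c.G (defect₂ f g h x l) + c.K (defect₁ g x l) = 0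
    rw [h₁ x l hl, h₂ x l hl, map_zero, map_zero, add_zero]
  have e₄ : compFun 0 f.fam (improve₁ f c g h).toFun =
      compFun 0 f.fam g.toFun + compFun 0 f.fam ((Fam.postcomp c.G (defect₂ f g h)).add
      (Fam.postcomp c.K (defect₁ g))).toFun := Fam.compFun_add_right _ _ _
  have e₅ : (Fam.one _ _ : Fam A.toGrBimod N.toGrMod N.toGrMod) x l =
      defect₂ f g h x l + compFun 0 f.fam g x l - homDiff (-1) h x l := by
    simp only [defect₂_toFun, Pi.add_apply, Pi.sub_apply]
    abel
  rw [defect₂_toFun, e₄, improve₂, homDiff_add, homDiff_add]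
  simp only [Pi.add_apply, Pi.sub_apply]
  rw [e₁, e₂, e₃]
  have e₆ := c.homotopy_right (defect₂ f g h x l)
  have e₇ := c.coherence (defect₁ g x l)
  have e₈ : (-2 : ℤ).negOnePow = 1 := by decide
  simp only [Int.negOnePow_neg, Int.negOnePow_one, Units.neg_smul, one_smul, e₈,
    Pi.zero_apply, map_zero, map_add]
  -- The new defect is minus the error in `homotopy_right` at the old second defect, minus the left
  -- side of `coherence` at the old first defect.
  refine Eq.trans ?_ (congrArg₂ (fun u v => -u - v) (sub_eq_zero.mpr e₆) e₇ |>.trans (by simp))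
  rw [e₅]
  abel

end

/-- The iterated improvements of the approximate inverse `0`. -/
noncomputable def approx (f : Hom M N) (c : ConeContraction f) :
    ℕ → Fam A.toGrBimod N.toGrMod M.toGrMod × Fam A.toGrBimod N.toGrMod N.toGrMod
  | 0 => (Fam.zero _ _ _, Fam.zero _ _ _)
  | n + 1 => (improve₁ f c (approx f c n).1 (approx f c n).2,
      improve₂ f c (approx f c n).1 (approx f c n).2)

section

variable (f : Hom M N) (c : ConeContraction f)

theorem approx_homog (n : ℕ) :
    (approx f c n).1.IsHomog 0 ∧ (approx f c n).2.IsHomog (-1) := by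
  induction n with
  | zero => exact ⟨Fam.zero_homog _, Fam.zero_homog _⟩
  | succ n ih => exact ⟨improve₁_homog c ih.1 ih.2, improve₂_homog c ih.1 ih.2⟩

/-- Each improvement gains one length. The start is vacuous, so the zero families may serve as the
initial approximation. -/
theorem approx_defect (n : ℕ) (x : N.toGrMod) (l : List A.carrier) (hl : l.length < n) :
    defect₁ (approx f c n).1 x l = 0 ∧ defect₂ f (approx f c n).1 (approx f c n).2 x l = 0 := by
  induction n generalizing x l with
  | zero => exact absurd hl (Nat.not_lt_zero _)
  | succ n ih =>
    have h := approx_homog f c n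
    exact ⟨defect₁_improve c h.1 h.2 (fun x l hl => (ih x l hl).1) (fun x l hl => (ih x l hl).2)
        x (Nat.lt_succ_iff.mp hl),
      defect₂_improve c h.1 h.2 (fun x l hl => (ih x l hl).1) (fun x l hl => (ih x l hl).2)
        x (Nat.lt_succ_iff.mp hl)⟩

/-- A correction at given arguments is linear in the defects at the same arguments, so it is zero
wherever they already vanish. -/
theorem approx_stable {n m : ℕ} (hnm : n ≤ m) (x : N.toGrMod) (l : List A.carrier)
    (hl : l.length < n) :
    (approx f c m).1 x l = (approx f c n).1 x l ∧ (approx f c m).2 x l = (approx f c n).2 x l := by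
  induction m, hnm using Nat.le_induction with
  | base => exact ⟨rfl, rfl⟩
  | succ m hm ih =>
    have h := approx_defect f c m x l (hl.trans_le hm)
    rw [← ih.1, ← ih.2]
    change improve₁ f c _ _ x l = _ ∧ improve₂ f c _ _ x l = _
    rw [improve₁_apply, improve₂_apply, h.1, h.2]
    simp

/-- A morphism whose first component has a contractible cone has a right inverse up to
homotopy. -/
theorem exists_right_inverse (f : Hom M N) (c : ConeContraction f) : ∃ g : Hom N M,
    ∃ h : Fam A.toGrBimod N.toGrMod N.toGrMod, h.IsHomog (-1) ∧
      compFun 0 f.fam g.fam - (Fam.one A.toGrBimod N.toGrMod).toFun =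
        diffFun A (-1) h + compFun (-1) N.act h + compFun 1 h N.act := by
  -- Stage `n` is final on lists of length less than `n`, so length `n` is read off from stage `n +
  -- 1`. The diagonal is the limit, and on lists no longer than `l` it agrees with a single stage.
  let g := Fam.diagonal fun n => (approx f c (n + 1)).1
  let h := Fam.diagonal fun n => (approx f c (n + 1)).2
  have hg : ∀ (l : List A.carrier) (x : N.toGrMod) (l' : List A.carrier),
      l'.length ≤ l.length → g x l' = (approx f c (l.length + 1)).1 x l' := fun l x l' hl =>
    (approx_stable f c (Nat.succ_le_succ hl) x l' (Nat.lt_succ_self _)).1.symm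
  have hh : ∀ (l : List A.carrier) (x : N.toGrMod) (l' : List A.carrier),
      l'.length ≤ l.length → h x l' = (approx f c (l.length + 1)).2 x l' := fun l x l' hl =>
    (approx_stable f c (Nat.succ_le_succ hl) x l' (Nat.lt_succ_self _)).2.symm
  have e₁ : (homDiff 0 g).toFun = 0 := by
    funext x l
    have := (approx_defect f c (l.length + 1) x l (Nat.lt_succ_self _)).1
    rw [homDiff_congr (hg l)]
    simpa [defect₁_toFun] using this
  have e₂ : (homDiff (-1) h).toFun =
      compFun 0 f.fam g - (Fam.one A.toGrBimod N.toGrMod).toFun := by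
    funext x l
    have := (approx_defect f c (l.length + 1) x l (Nat.lt_succ_self _)).2
    rw [homDiff_congr (hh l), Pi.sub_apply, Pi.sub_apply, Fam.compFun_congr_right _ (hg l),
      ← sub_eq_zero, ← this]
    simp only [defect₂_toFun, Pi.add_apply, Pi.sub_apply]
    abel
  refine ⟨⟨g, Fam.diagonal_homog fun n => (approx_homog f c _).1, ?_⟩, h,
    Fam.diagonal_homog fun n => (approx_homog f c _).2, ?_⟩
  · simpa [homDiff_toFun] using e₁
  · rw [← e₂, homDiff_toFun]
    simp [sub_eq_add_neg]

end
end AInfModule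
end AInf

/-! ### Contracting the cone over a semisimple ring -/

namespace AInf

/-- An exact complex of modules over a semisimple ring is contractible. -/
theorem exists_contraction {R : Type*} [Ring R] [IsSemisimpleRing R] {C : ℤ → Type*}
    [∀ i, AddCommGroup (C i)] [∀ i, Module R (C i)] (δ : ∀ i, C i →ₗ[R] C (i + 1))
    (hδ : ∀ i x, δ (i + 1) (δ i x) = 0)
    (hex : ∀ i x, δ (i + 1) x = 0 → ∃ y, δ i y = x) :
    ∃ s : ∀ i, C (i + 1) →ₗ[R] C i, ∀ i x, δ i (s i x) + s (i + 1) (δ (i + 1) x) = x := by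
  -- `π` projects onto the cycles, which have a complement by semisimplicity.
  have hπ : ∀ i, ∃ π : C i →ₗ[R] C i, (∀ x, δ i (π x) = 0) ∧ ∀ x, δ i x = 0 → π x = x := by
    intro i
    obtain ⟨q, hq⟩ := exists_isCompl (LinearMap.ker (δ i))
    exact ⟨Submodule.projection _ _ hq, fun x => Submodule.projection_apply_mem hq x,
      fun x hx => Submodule.projection_apply_left hq ⟨x, hx⟩⟩
  choose π hπ₁ hπ₂ using hπ
  -- `τ` chooses primitives of cycles linearly: by exactness `δ` maps onto the cycles, and these
  -- form a projective module.
  have hτ : ∀ i, ∃ τ : C (i + 1) →ₗ[R] C i, ∀ x, δ (i + 1) x = 0 → δ i (τ x) = x := by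
    intro i
    let δ' : C i →ₗ[R] LinearMap.ker (δ (i + 1)) := (δ i).codRestrict _ fun x => hδ i x
    have hs : Function.Surjective δ' := fun ⟨x, hx⟩ => by
      obtain ⟨y, hy⟩ := hex i x hx
      exact ⟨y, Subtype.ext hy⟩
    have : Module.Projective R (LinearMap.ker (δ (i + 1))) :=
      Module.projective_of_isSemisimpleRing _ _
    obtain ⟨σ, hσ⟩ := Module.projective_lifting_property δ' LinearMap.id hs
    refine ⟨σ ∘ₗ (π (i + 1)).codRestrict _ (hπ₁ (i + 1)), fun x hx => ?_⟩
    have h := congrArg Subtype.val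
      (LinearMap.congr_fun hσ ((π (i + 1)).codRestrict _ (hπ₁ (i + 1)) x))
    exact h.trans (hπ₂ _ x hx)
  choose τ hτ using hτ
  -- With `s = (1 - π) τ π` one gets `δ s x = π x`. As `τ δ x - x` is a cycle, it is fixed by `π`,
  -- whence `s δ x = x - π x`.
  refine ⟨fun i => (LinearMap.id - π i) ∘ₗ τ i ∘ₗ π (i + 1), fun i x => ?_⟩
  simp only [LinearMap.comp_apply, LinearMap.sub_apply, LinearMap.id_apply, map_sub, hπ₁,
    sub_zero, hτ i _ (hπ₁ _ x), hπ₂ _ _ (hδ _ x)]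
  have h : δ (i + 1) (τ (i + 1) (δ (i + 1) x) - x) = 0 := by
    rw [map_sub, hτ _ _ (hδ _ x), sub_self]
  have h' := hπ₂ _ _ h
  rw [map_sub, sub_eq_iff_eq_add] at h'
  rw [h']
  abel

namespace GrMod

variable {S : Type u₂} [Ring S] {M N : GrMod.{u₂, w} S}

theorem hom_ext {φ ψ : M →ₗ[Sᵐᵒᵖ] N} (h : ∀ i, ∀ x ∈ M.deg i, φ x = ψ x) : φ = ψ := by
  ext x
  induction x using DirectSum.Decomposition.inductionOn M.deg with
  | zero => simp
  | add x y hx hy => simp only [map_add, hx, hy]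
  | @homogeneous j x => exact h j x x.2

/-- The entries of the contraction are indexed by the degree `i` of the cone, while their sources
lie in degrees `i + 1` and `i + 1 + 1`. The bijection `σ` absorbs this shift. -/
theorem exists_linearMap (σ : ℤ ≃ ℤ) (φ : ∀ i, M.deg (σ i) →ₗ[Sᵐᵒᵖ] N) :
    ∃ Φ : M →ₗ[Sᵐᵒᵖ] N, ∀ i (x : M.deg (σ i)), Φ x = φ i x := by
  refine ⟨(DirectSum.toModule Sᵐᵒᵖ ℤ N fun j => φ (σ.symm j) ∘ₗ
    Submodule.inclusion (le_of_eq (by rw [σ.apply_symm_apply]))) ∘ₗ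
      (DirectSum.decomposeLinearEquiv M.deg).toLinearMap, fun i x => ?_⟩
  have h := DirectSum.decomposeLinearEquiv_apply_coe M.deg (σ i) x
  simp only [LinearMap.comp_apply, LinearEquiv.coe_coe, h, DirectSum.toModule_lof]
  have key : ∀ (i' : ℤ) (e : i' = i) (hx : (x : M) ∈ M.deg (σ i')), φ i' ⟨x, hx⟩ = φ i x := by
    rintro _ rfl _
    rfl
  exact key _ (σ.symm_apply_apply i) _

end GrMod

variable {k : Type u₁} {S : Type u₂} [Field k] [Ring S] [Algebra k S]

namespace AInfModule

variable {A : AInfAlgebra.{u₁, u₂, v} k S} {M N : AInfModule.{u₁, u₂, v, w} A}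

theorem Hom.first_mem (f : Hom M N) {i : ℤ} {x : M.toGrMod} (hx : x ∈ M.deg i) :
    f.fam.first x ∈ N.deg i :=
  Fam.first_mem f.homog (add_zero i) x hx

/-- The cone of the first component of `f` is acyclic. -/
def ConeAcyclic (f : Hom M N) : Prop :=
  ∀ i, ∀ x ∈ M.deg (i + 1 + 1), ∀ y ∈ N.deg (i + 1), M.act.first x = 0 →
    f.fam.first x = N.act.first y →
      ∃ x' ∈ M.deg (i + 1), ∃ y' ∈ N.deg i,
        M.act.first x' = x ∧ f.fam.first x' - N.act.first y' = y

/-- The differential of the cone of the first component of `f`. -/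
def coneDiff (f : Hom M N) (i : ℤ) :
    (M.deg (i + 1) × N.deg i) →ₗ[Sᵐᵒᵖ] (M.deg (i + 1 + 1) × N.deg (i + 1)) :=
  (M.differential rfl ∘ₗ LinearMap.fst _ _ _).prod
    (f.firstAt (i + 1) ∘ₗ LinearMap.fst _ _ _ - N.differential rfl ∘ₗ LinearMap.snd _ _ _)

theorem coneDiff_fst (f : Hom M N) (i : ℤ) (z : M.deg (i + 1) × N.deg i) :
    ((coneDiff f i z).1 : M.toGrMod) = M.act.first z.1 := rfl

theorem coneDiff_snd (f : Hom M N) (i : ℤ) (z : M.deg (i + 1) × N.deg i) :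
    ((coneDiff f i z).2 : N.toGrMod) = f.fam.first z.1 - N.act.first z.2 := rfl

/-- The general contraction is applied to the cone with terms `M_{i+1} × N_i`. Its matrix entries,
assembled over all degrees, are `K`, `G`, `E` and `H`. -/
theorem ConeAcyclic.nonempty_contraction [IsSemisimpleRing Sᵐᵒᵖ] {f : Hom M N}
    (hf : ConeAcyclic f) : Nonempty (ConeContraction f) := by
  obtain ⟨s, hs⟩ := exists_contraction (C := fun i => M.deg (i + 1) × N.deg i) (coneDiff f)
    (fun i z => by
      refine Prod.ext (Subtype.ext ?_) (Subtype.ext ?_)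
      · simp only [coneDiff_fst, M.act_first_first]
        rfl
      · simp only [coneDiff_snd, coneDiff_fst, map_sub, N.act_first_first, f.first_comm, sub_zero,
          sub_self]
        rfl)
    (fun i z hz => by
      have h₁ := congrArg (fun z => (z.1 : M.toGrMod)) hz
      have h₂ := congrArg (fun z => (z.2 : N.toGrMod)) hz
      obtain ⟨x, hx, y, hy, e₁, e₂⟩ := hf i z.1 z.1.2 z.2 z.2.2 h₁ (sub_eq_zero.mp h₂)
      exact ⟨(⟨x, hx⟩, ⟨y, hy⟩), Prod.ext (Subtype.ext e₁) (Subtype.ext e₂)⟩)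
  let σ : ℤ ≃ ℤ := Equiv.addRight 1
  obtain ⟨K, hK⟩ := GrMod.exists_linearMap (M := M.toGrMod) (N := M.toGrMod) (σ.trans σ)
    fun i => (M.deg (i + 1)).subtype ∘ₗ LinearMap.fst _ _ _ ∘ₗ s i ∘ₗ LinearMap.inl _ _ _
  obtain ⟨G, hG⟩ := GrMod.exists_linearMap (M := N.toGrMod) (N := M.toGrMod) σ
    fun i => (M.deg (i + 1)).subtype ∘ₗ LinearMap.fst _ _ _ ∘ₗ s i ∘ₗ LinearMap.inr _ _ _
  obtain ⟨E, hE⟩ := GrMod.exists_linearMap (M := M.toGrMod) (N := N.toGrMod) (σ.trans σ)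
    fun i => (N.deg i).subtype ∘ₗ LinearMap.snd _ _ _ ∘ₗ s i ∘ₗ LinearMap.inl _ _ _
  obtain ⟨H, hH⟩ := GrMod.exists_linearMap (M := N.toGrMod) (N := N.toGrMod) σ
    fun i => (N.deg i).subtype ∘ₗ LinearMap.snd _ _ _ ∘ₗ s i ∘ₗ LinearMap.inr _ _ _
  have hs₁ : ∀ i (x : M.deg (i + 1 + 1)) (y : N.deg (i + 1)),
      ((s i (x, y)).1 : M.toGrMod) = K x + G y := by
    intro i x y
    refine Eq.trans ?_ (congrArg₂ (· + ·) (hK i x) (hG i y)).symm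
    have h : ((x, y) : M.deg (i + 1 + 1) × N.deg (i + 1)) = (x, 0) + (0, y) := by simp
    rw [h, map_add]
    rfl
  have hs₂ : ∀ i (x : M.deg (i + 1 + 1)) (y : N.deg (i + 1)),
      ((s i (x, y)).2 : N.toGrMod) = E x + H y := by
    intro i x y
    refine Eq.trans ?_ (congrArg₂ (· + ·) (hE i x) (hH i y)).symm
    have h : ((x, y) : M.deg (i + 1 + 1) × N.deg (i + 1)) = (x, 0) + (0, y) := by simp
    rw [h, map_add]
    rfl
  replace hs₁ : ∀ i z, ((s i z).1 : M.toGrMod) = K z.1 + G z.2 := fun i z => hs₁ i z.1 z.2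
  replace hs₂ : ∀ i z, ((s i z).2 : N.toGrMod) = E z.1 + H z.2 := fun i z => hs₂ i z.1 z.2
  -- `e₁` and `e₂` are the two components of `∂ s + s ∂ = id`. Putting `x = 0` or `y = 0` in each of
  -- them gives the four identities of `ConeContraction`.
  have e₁ : ∀ i, ∀ x ∈ M.deg (i + 1 + 1), ∀ y ∈ N.deg (i + 1),
      M.act.first (K x + G y) + (K (M.act.first x) + G (f.fam.first x - N.act.first y)) = x := by
    intro i x hx y hy
    have h := congrArg (fun z => (z.1 : M.toGrMod)) (hs i (⟨x, hx⟩, ⟨y, hy⟩))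
    simpa only [Prod.fst_add, Submodule.coe_add, coneDiff_fst, coneDiff_snd, hs₁] using h
  have e₂ : ∀ i, ∀ x ∈ M.deg (i + 1 + 1), ∀ y ∈ N.deg (i + 1),
      f.fam.first (K x + G y) - N.act.first (E x + H y) +
        (E (M.act.first x) + H (f.fam.first x - N.act.first y)) = y := by
    intro i x hx y hy
    have h := congrArg (fun z => (z.2 : N.toGrMod)) (hs i (⟨x, hx⟩, ⟨y, hy⟩))
    simpa only [Prod.snd_add, Submodule.coe_add, coneDiff_fst, coneDiff_snd, hs₁, hs₂] using h
  have hM : ∀ j, ∃ i : ℤ, j = i + 1 + 1 := fun j => ⟨j - 2, by ring⟩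
  have hN : ∀ j, ∃ i : ℤ, j = i + 1 := fun j => ⟨j - 1, by ring⟩
  exact ⟨{
    K := K
    G := G
    E := E
    H := H
    K_mem := fun j x hx => by
      obtain ⟨i, rfl⟩ := hM j
      rw [show i + 1 + 1 + -1 = i + 1 by ring]
      exact (hK i ⟨x, hx⟩).symm ▸ Subtype.property _
    G_mem := fun j x hx => by
      obtain ⟨i, rfl⟩ := hN j
      rw [add_zero]
      exact (hG i ⟨x, hx⟩).symm ▸ Subtype.property _
    E_mem := fun j x hx => by
      obtain ⟨i, rfl⟩ := hM j
      rw [show i + 1 + 1 + -2 = i by ring]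
      exact (hE i ⟨x, hx⟩).symm ▸ Subtype.property _
    H_mem := fun j x hx => by
      obtain ⟨i, rfl⟩ := hN j
      rw [show i + 1 + -1 = i by ring]
      exact (hH i ⟨x, hx⟩).symm ▸ Subtype.property _
    comm_G := LinearMap.congr_fun (f := M.act.first ∘ₗ G) (g := G ∘ₗ N.act.first)
      (GrMod.hom_ext fun j y hy => by
        obtain ⟨i, rfl⟩ := hN j
        have h := e₁ i 0 (zero_mem _) y hy
        simpa [add_neg_eq_zero] using h)
    homotopy_left := LinearMap.congr_fun
      (f := G ∘ₗ f.fam.first + M.act.first ∘ₗ K + K ∘ₗ M.act.first) (g := LinearMap.id)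
      (GrMod.hom_ext fun j x hx => by
        obtain ⟨i, rfl⟩ := hM j
        have h := e₁ i x hx 0 (zero_mem _)
        simp only [map_zero, add_zero, sub_zero] at h
        refine Eq.trans ?_ h
        simp only [LinearMap.add_apply, LinearMap.comp_apply]
        abel)
    homotopy_right := LinearMap.congr_fun
      (f := f.fam.first ∘ₗ G - N.act.first ∘ₗ H - H ∘ₗ N.act.first) (g := LinearMap.id)
      (GrMod.hom_ext fun j y hy => by
        obtain ⟨i, rfl⟩ := hN j
        have h := e₂ i 0 (zero_mem _) y hy
        simp only [map_zero, zero_add, zero_sub, map_neg] at h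
        refine Eq.trans ?_ h
        simp only [LinearMap.sub_apply, LinearMap.comp_apply]
        abel)
    coherence := LinearMap.congr_fun
      (f := f.fam.first ∘ₗ K + H ∘ₗ f.fam.first - N.act.first ∘ₗ E + E ∘ₗ M.act.first) (g := 0)
      (GrMod.hom_ext fun j x hx => by
        obtain ⟨i, rfl⟩ := hM j
        have h := e₂ i x hx 0 (zero_mem _)
        simp only [map_zero, add_zero, sub_zero] at h
        refine Eq.trans ?_ h
        simp only [LinearMap.add_apply, LinearMap.sub_apply, LinearMap.comp_apply]
        abel) }⟩

/-! ### Acyclicity of the cone and two-sided inverses -/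

theorem complex_d (M : AInfModule.{u₁, u₂, v, w} A) {i j : ℤ} (h : i + 1 = j) :
    M.complex.d i j = ModuleCat.ofHom (M.differential h) := dif_pos h

/-- Injectivity and surjectivity on homology, written with elements as `inj` and `surj`, yield
exactness of the cone by a diagram chase. -/
theorem IsQuasiIso.coneAcyclic {f : M ⟶ N} (hf : IsQuasiIso f) : ConeAcyclic f := by
  have hf' : QuasiIso (Hom.firstComplex f) := hf
  have hiso : ∀ i, IsIso (HomologicalComplex.homologyMap (Hom.firstComplex f) i) := fun i =>
    (quasiIsoAt_iff_isIso_homologyMap _ _).mp inferInstance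
  have hprev : ∀ i : ℤ, (ComplexShape.up ℤ).prev (i + 1) = i := fun i =>
    ComplexShape.prev_eq' _ rfl
  have hnext : ∀ i : ℤ, (ComplexShape.up ℤ).next i = i + 1 := fun i =>
    ComplexShape.next_eq' _ rfl
  have inj : ∀ i, ∀ x ∈ M.deg (i + 1), ∀ y ∈ N.deg i, M.act.first x = 0 →
      f.fam.first x = N.act.first y → ∃ x' ∈ M.deg i, M.act.first x' = x := by
    intro i x hx y hy h₁ h₂
    have h := (HomologicalComplex.mono_homologyMap_iff_up_to_refinements (Hom.firstComplex f)
      i (i + 1) (i + 1 + 1) (hprev i) (hnext _)).mp inferInstance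
    -- The universal test object: the module of all pairs `(x, y)` with `d x = 0` and `f x = d y`.
    -- The refinement of `P` is surjective, so the given pair lifts to it. In `surj` the test object
    -- is the module of cycles of `N`.
    let P : Submodule Sᵐᵒᵖ (M.deg (i + 1) × N.deg i) := LinearMap.ker (coneDiff f i)
    obtain ⟨A', π, hπ, z, hz⟩ := h (A := ModuleCat.of Sᵐᵒᵖ P)
      (ModuleCat.ofHom (LinearMap.fst _ _ _ ∘ₗ P.subtype)) (by
        rw [complex_d _ rfl]
        exact ModuleCat.hom_ext (LinearMap.ext fun p => congrArg Prod.fst p.2))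
      (ModuleCat.ofHom (LinearMap.snd _ _ _ ∘ₗ P.subtype)) (by
        rw [complex_d _ rfl]
        refine ModuleCat.hom_ext (LinearMap.ext fun p => ?_)
        have h : f.firstAt (i + 1) p.1.1 - N.differential rfl p.1.2 = 0 := congrArg Prod.snd p.2
        exact sub_eq_zero.mp h)
    obtain ⟨a, ha⟩ := (ModuleCat.epi_iff_surjective π).mp hπ
      ⟨(⟨x, hx⟩, ⟨y, hy⟩), Prod.ext (Subtype.ext h₁) (Subtype.ext (sub_eq_zero.mpr h₂))⟩
    rw [complex_d _ rfl] at hz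
    have h := congrArg Subtype.val (congrArg (fun φ => φ.hom a) hz)
    refine ⟨_, (z.hom a).2, h.symm.trans ?_⟩
    exact congrArg (fun p : P => (p.1.1 : M.toGrMod)) ha
  have surj : ∀ i, ∀ y ∈ N.deg (i + 1), N.act.first y = 0 →
      ∃ x ∈ M.deg (i + 1), ∃ y' ∈ N.deg i, M.act.first x = 0 ∧
        y = f.fam.first x + N.act.first y' := by
    intro i y hy h₁
    have h := (HomologicalComplex.epi_homologyMap_iff_up_to_refinements (Hom.firstComplex f)
      i (i + 1) (i + 1 + 1) (hprev i) (hnext _)).mp inferInstance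
    let P : Submodule Sᵐᵒᵖ (N.deg (i + 1)) := LinearMap.ker (N.differential rfl)
    obtain ⟨A', π, hπ, z, hz, u, hu⟩ := h (A := ModuleCat.of Sᵐᵒᵖ P)
      (ModuleCat.ofHom P.subtype) (by
        rw [complex_d _ rfl]
        exact ModuleCat.hom_ext (LinearMap.ext fun p => p.2))
    obtain ⟨a, ha⟩ := (ModuleCat.epi_iff_surjective π).mp hπ ⟨⟨y, hy⟩, Subtype.ext h₁⟩
    rw [complex_d _ rfl] at hz hu
    have e₁ := congrArg Subtype.val (congrArg (fun φ => φ.hom a) hz)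
    have e₂ := congrArg Subtype.val (congrArg (fun φ => φ.hom a) hu)
    refine ⟨_, (z.hom a).2, _, (u.hom a).2, e₁, Eq.trans ?_ e₂⟩
    exact (congrArg (fun p : P => (p.1 : N.toGrMod)) ha).symm
  intro i x hx y hy h₁ h₂
  -- With `x = d x₀`, the element `f x₀ - y` is a cycle, hence equal to `f z + d y'` with `d z = 0`.
  -- The pair `(x₀ - z, y')` is then the required primitive.
  obtain ⟨x₀, hx₀, rfl⟩ := inj _ x hx y hy h₁ h₂
  obtain ⟨z, hz, y', hy', h₃, h₄⟩ := surj i (f.fam.first x₀ - y)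
    (sub_mem (Hom.first_mem f hx₀) hy) (by rw [map_sub, Hom.first_comm f, h₂, sub_self])
  refine ⟨x₀ - z, sub_mem hx₀ hz, y', hy', by rw [map_sub, h₃, sub_zero], ?_⟩
  rw [map_sub, sub_sub, ← h₄, sub_sub_cancel]

/-- On homology `f_1` is bijective and `f_1 g_1` is the identity, so `g_1` is bijective as well. The
proof makes this explicit, using only the first component `f_1 g_1 = 1 + d h + h d` of the homotopy.
-/
theorem ConeAcyclic.of_right_inverse {f : Hom M N} (hf : ConeAcyclic f) {g : Hom N M}
    {h : Fam A.toGrBimod N.toGrMod N.toGrMod} (hh : h.IsHomog (-1))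
    (e : compFun 0 f.fam g.fam - (Fam.one A.toGrBimod N.toGrMod).toFun =
      diffFun A (-1) h + compFun (-1) N.act h + compFun 1 h N.act) : ConeAcyclic g := by
  have e' : ∀ y, f.fam.first (g.fam.first y) =
      y + N.act.first (h.first y) + h.first (N.act.first y) := by
    intro y
    have ht : triples 0 = ∅ := by
      ext y
      simp only [mem_triples, Finset.notMem_empty, iff_false]
      omega
    have := congrFun (congrFun e y) []
    simp [diffFun, compFun, ht, Fam.one, sub_eq_iff_eq_add] at this
    change f.fam (g.fam y []) [] = y + N.act (h y []) [] + h (N.act y []) []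
    rw [this]
    abel
  intro i y hy x hx h₁ h₂
  have hmem : ∀ {j} {y : N.toGrMod}, y ∈ N.deg (j + 1) → h.first y ∈ N.deg j := fun {j y} hy =>
    Fam.first_mem hh (by ring) y hy
  -- From `g y = d x` and `d y = 0` it follows that `d (f x) = f g y = y + d h y`, so `y₀ = f x - h
  -- y` is a primitive of `y`.
  have hy₀ : f.fam.first x - h.first y ∈ N.deg (i + 1) := sub_mem (f.first_mem hx) (hmem hy)
  have d₀ : N.act.first (f.fam.first x - h.first y) = y := by
    rw [map_sub, f.first_comm, ← h₂, e', h₁, map_zero]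
    abel
  obtain ⟨j, rfl⟩ : ∃ j, i = j + 1 := ⟨i - 1, by ring⟩
  -- The error `x - g y₀` is a cycle whose image under `f` is the boundary `d (-h y₀)`. Acyclicity
  -- of the cone of `f` therefore makes it a boundary `d x'`.
  obtain ⟨x', hx', y', hy', e₁, e₂⟩ := hf j (x - g.fam.first (f.fam.first x - h.first y))
    (sub_mem hx (g.first_mem hy₀)) (-h.first (f.fam.first x - h.first y)) (neg_mem (hmem hy₀))
    (by rw [map_sub, g.first_comm, d₀, h₂, sub_self])
    (by rw [map_sub, e', d₀, map_neg]; abel)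
  refine ⟨_, hy₀, -x', neg_mem hx', d₀, ?_⟩
  rw [map_neg, e₁]
  abel

theorem ConeAcyclic.exists_right_inverse [IsSemisimpleRing Sᵐᵒᵖ] {f : M ⟶ N}
    (hf : ConeAcyclic f) : ∃ g : N ⟶ M, ConeAcyclic g ∧ Homotopic (g ≫ f) (𝟙 N) := by
  obtain ⟨c⟩ := hf.nonempty_contraction
  obtain ⟨g, h, hh, e⟩ := AInfModule.exists_right_inverse f c
  exact ⟨g, hf.of_right_inverse hh e, h, hh, e⟩

/-- If `g` is a right inverse of `f` and `f'` a right inverse of `g`, then up to homotopy `f = f g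
f' = f'`. Hence `g f` is homotopic to `g f'`, and so to the identity. -/
theorem ConeAcyclic.isHomotopyEquiv [IsSemisimpleRing Sᵐᵒᵖ] {f : M ⟶ N}
    (hf : ConeAcyclic f) : IsHomotopyEquiv f := by
  obtain ⟨g, hg, hgf⟩ := hf.exists_right_inverse
  obtain ⟨f', -, hf'⟩ := hg.exists_right_inverse
  refine ⟨g, ?_, hgf⟩
  have h₁ := homotopic_precomp f' hgf
  rw [Category.comp_id, ← Category.assoc] at h₁
  have h₂ := homotopic_postcomp f hf'
  rw [Category.id_comp] at h₂
  exact homotopic_trans (homotopic_postcomp g (homotopic_trans (homotopic_symm h₂) h₁)) hf'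

theorem IsHomotopyEquiv.isIso_map {f : M ⟶ N} (hf : IsHomotopyEquiv f) :
    IsIso ((toHomotopyCat A).map f) := by
  obtain ⟨g, h₁, h₂⟩ := hf
  refine ⟨(toHomotopyCat A).map g, ?_, ?_⟩
  · rw [← Functor.map_comp, ← (toHomotopyCat A).map_id]
    exact CategoryTheory.Quotient.sound _ h₁
  · rw [← Functor.map_comp, ← (toHomotopyCat A).map_id]
    exact CategoryTheory.Quotient.sound _ h₂

end AInfModule
end AInf

theorem mainTheorem11 {k : Type u₁} [Field k] {ι : Type u₃} [Finite ι] {S : Type u₂} [Ring S]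
    [Algebra k S] (e : S ≃ₐ[k] (ι → k)) (A : AInf.AInfAlgebra.{u₁, u₂, v} k S)
    {M N : AInf.AInfModule.{u₁, u₂, v, w} A} (f : M ⟶ N) (hf : AInf.AInfModule.IsQuasiIso f) :
    AInf.AInfModule.IsHomotopyEquiv f ∧ IsIso ((AInf.AInfModule.toHomotopyCat A).map f) := by
  -- A finite product of fields is semisimple, and so is the opposite ring, over which right modules
  -- are formed.
  have : IsSemisimpleRing S := e.symm.toRingEquiv.isSemisimpleRing
  have h := (AInf.AInfModule.IsQuasiIso.coneAcyclic hf).isHomotopyEquiv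
  exact ⟨h, h.isIso_map⟩
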